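/- Let $\Lambda\subset\mathbb{C}$ be a finite nonempty set, let $c_\lambda\neq 0$ be complex numbers for $\lambda\in\Lambda$, and let $$f(z)=\sum_{\lambda\in\Lambda}c_\lambda e^{\bar\lambda z},\qquad z\in\mathbb{C},$$ be the corresponding exponential sum. Let its Newton polygon $\Delta$ be the convex hull of $\Lambda$, and let $l(f)$ be the semiperimeter of $\Delta$, i.e. half the sum of the lengths of its sides; if $\Delta$ is a segment, $l(f)$ is the length of this segment (and $l(f)=0$ if $\Delta$ is a point). For $r\ge 0$ let $N(f,r)$ be the number of zeros of $f$, counted with multiplicities, in the disk $\{z\in\mathbb{C}:|z|\le r\}$. Then $N(f,r)$ is finite for every $r$, and $$N(f,r)=\frac{r}{\pi}\,l(f)+O(1),$$ i.e. there is a constant $C$, depending only on $f$, such that $\left|N(f,r)-\frac{r}{\pi}\,l(f)\right|\le C$ for all $r\ge 0$. -/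

import Mathlib

namespace ExponentialSum

/-- The exponential sum `∑ a ∈ Λ, c a * exp (conj a * z)` with spectrum `Λ` and coefficients `c`. -/
noncomputable def expSum (Λ : Finset ℂ) (c : ℂ → ℂ) (z : ℂ) : ℂ :=
  ∑ a ∈ Λ, c a * Complex.exp ((starRingEnd ℂ) a * z)

/-- The Newton polygon: the convex hull of the spectrum. -/
def newtonPolygon (Λ : Finset ℂ) : Set ℂ :=
  convexHull ℝ (Λ : Set ℂ)

/-- The face of `Δ` with outward normal `u`: the points of `Δ` at which the real linear function
`x ↦ Re (conj u * x)` attains its maximum over `Δ`. -/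
def face (Δ : Set ℂ) (u : ℂ) : Set ℂ :=
  {x | x ∈ Δ ∧ ∀ y ∈ Δ, inner ℝ u y ≤ inner ℝ u x}

/-- Half the sum of the lengths of the sides of the convex polygon `Δ`. The sides are the faces
of positive length, one for each outward unit normal `u` (for every other unit vector `u` the face
is a vertex and contributes `0`). A segment is the face for both of its unit normals, so its
perimeter is twice its length, and its semiperimeter is its length. -/
noncomputable def semiperimeter (Δ : Set ℂ) : ℝ :=
  (∑ᶠ u ∈ Metric.sphere (0 : ℂ) 1, Metric.diam (face Δ u)) / 2

/-- The number of zeros of `f` in the closed disk of radius `r` centered at the origin, counted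
with multiplicities. -/
noncomputable def zeroCount (f : ℂ → ℂ) (r : ℝ) : ℕ :=
  ∑ᶠ z ∈ Metric.closedBall (0 : ℂ) r, analyticOrderNatAt f z

/-- Faces of positive length contain two distinct points of the spectrum. -/
theorem exists_pair_of_diam_face_ne_zero (Λ : Finset ℂ) (u : ℂ)
    (h : Metric.diam (face (newtonPolygon Λ) u) ≠ 0) :
    ∃ a ∈ Λ, ∃ b ∈ Λ, a ≠ b ∧ inner ℝ u a = inner ℝ u b := by
  by_contra! hno
  apply h
  apply Metric.diam_subsingleton
  intro x hx y hy
  obtain ⟨hxΔ, hxm⟩ := hx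
  obtain ⟨hyΔ, hym⟩ := hy
  -- every maximum point is equal to any spectrum point of maximal value
  have key : ∀ x ∈ newtonPolygon Λ, (∀ y ∈ newtonPolygon Λ, inner ℝ u y ≤ inner ℝ u x) →
      ∀ p ∈ Λ, inner ℝ u x ≤ inner ℝ u p → x = p := by
    intro x hx hm p hp hxp
    have hsub : ∀ a ∈ Λ, a ∈ newtonPolygon Λ := fun a ha =>
      subset_convexHull ℝ _ (Finset.mem_coe.2 ha)
    obtain ⟨w, hw0, hw1, hwx⟩ := Finset.mem_convexHull'.1 hx
    have hin : inner ℝ u x = ∑ a ∈ Λ, w a * inner ℝ u a := by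
      rw [← hwx, inner_sum]
      simp only [inner_smul_right]
    have hz : ∑ a ∈ Λ, w a * (inner ℝ u x - inner ℝ u a) = 0 := by
      simp only [mul_sub, Finset.sum_sub_distrib, ← Finset.sum_mul, hw1, one_mul]
      rw [← hin, sub_self]
    have hz' := (Finset.sum_eq_zero_iff_of_nonneg (fun a ha =>
      mul_nonneg (hw0 a ha) (sub_nonneg.2 (hm a (hsub a ha))))).1 hz
    have hwz : ∀ a ∈ Λ, a ≠ p → w a = 0 := by
      intro a ha hap
      rcases mul_eq_zero.1 (hz' a ha) with h0 | h0
      · exact h0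
      · refine absurd ?_ (hno a ha p hp hap)
        linarith [hm p (hsub p hp)]
    have h1 : w p = 1 := by
      rw [← hw1]
      exact (Finset.sum_eq_single_of_mem p hp hwz).symm
    rw [← hwx, Finset.sum_eq_single_of_mem p hp
      (fun a ha hap => by rw [hwz a ha hap, zero_smul]), h1, one_smul]
  have hne : Λ.Nonempty := by
    rcases Λ.eq_empty_or_nonempty with h0 | h0
    · simp [newtonPolygon, h0] at hxΔ
    · exact h0
  obtain ⟨p, hp, hpm⟩ := Λ.exists_max_image (fun a => (inner ℝ u a : ℝ)) hne
  have hle : ∀ x ∈ newtonPolygon Λ, inner ℝ u x ≤ inner ℝ u p := by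
    intro x hx
    obtain ⟨w, hw0, hw1, hwx⟩ := Finset.mem_convexHull'.1 hx
    rw [← hwx, inner_sum]
    simp only [inner_smul_right]
    calc ∑ a ∈ Λ, w a * inner ℝ u a ≤ ∑ a ∈ Λ, w a * inner ℝ u p :=
          Finset.sum_le_sum fun a ha => mul_le_mul_of_nonneg_left (hpm a ha) (hw0 a ha)
      _ = inner ℝ u p := by rw [← Finset.sum_mul, hw1, one_mul]
  rw [key x hxΔ hxm p hp (hle x hxΔ), key y hyΔ hym p hp (hle y hyΔ)]

/-- A Newton polygon has finitely many sides, so that the sum defining its semiperimeter is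
a finite sum. -/
theorem finite_sides (Λ : Finset ℂ) :
    {u | u ∈ Metric.sphere (0 : ℂ) 1 ∧
      Metric.diam (face (newtonPolygon Λ) u) ≠ 0}.Finite := by
  have hfin : (⋃ q ∈ (Λ ×ˢ Λ).filter (fun q => q.1 ≠ q.2),
      ({Complex.I * (q.1 - q.2) / (‖q.1 - q.2‖ : ℂ),
        -(Complex.I * (q.1 - q.2) / (‖q.1 - q.2‖ : ℂ))} : Set ℂ)).Finite :=
    Set.Finite.biUnion (Finset.finite_toSet _) fun q _ => Set.toFinite _
  refine hfin.subset ?_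
  rintro u ⟨hu, hd⟩
  obtain ⟨a, ha, b, hb, hab, he⟩ := exists_pair_of_diam_face_ne_zero Λ u hd
  simp only [Set.mem_iUnion]
  refine ⟨(a, b), by simp [ha, hb, hab], ?_⟩
  have hn : (‖a - b‖ : ℂ) ≠ 0 := by
    simpa [sub_eq_zero] using hab
  have hu1 : u.re * u.re + u.im * u.im = 1 := by
    have h1 : ‖u‖ = 1 := by simpa using hu
    have h2 := Complex.normSq_eq_norm_sq u
    rw [h1, Complex.normSq_apply] at h2
    simpa using h2
  have hd2 : (‖a - b‖ : ℂ) * (‖a - b‖ : ℂ) =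
      (((a - b).re * (a - b).re + (a - b).im * (a - b).im : ℝ) : ℂ) := by
    rw [← Complex.normSq_apply, Complex.normSq_eq_norm_sq]
    push_cast
    ring
  have ho : u.re * (a - b).re + u.im * (a - b).im = 0 := by
    have h0 : inner ℝ u (a - b) = (0 : ℝ) := by rw [inner_sub_right, he, sub_self]
    rw [Complex.inner] at h0
    have h1 : (a - b).re * u.re + (a - b).im * u.im = 0 := by simpa using h0
    linarith
  have hsq : (u * (‖a - b‖ : ℂ)) ^ 2 = (Complex.I * (a - b)) ^ 2 := by
    rw [mul_pow, pow_two (‖a - b‖ : ℂ), hd2]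
    generalize a - b = d at ho ⊢
    apply Complex.ext
    · simp [pow_two]
      linear_combination (2 * u.re * d.re - 2 * u.im * d.im) * ho - (d.re ^ 2 - d.im ^ 2) * hu1
    · simp [pow_two]
      linear_combination (2 * u.re * d.im + 2 * u.im * d.re) * ho - (2 * d.re * d.im) * hu1
  simp only [Set.mem_insert_iff, Set.mem_singleton_iff]
  rcases sq_eq_sq_iff_eq_or_eq_neg.1 hsq with h1 | h1
  · left
    rw [eq_div_iff hn, h1]
  · right
    rw [← neg_div, eq_div_iff hn, h1]

end ExponentialSum

/-! Write f for `expSum Λ c`, S for `absSum Λ c`, h for the support function of Λ, N(t) for the zero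
count, and M_g(t) for the mean of log|g| over |z| = t. Jensen's formula gives N(s) log(t/s) ≤ M_f(t)
- M_f(s) ≤ N(t) log(t/s). Over a step of length one the logarithm is about 1/t, so increments of M_f
known up to O(1/t) determine N(t) up to O(1).

The increments of M_S are accessible. Along the ray through a unit vector u, log S grows at rate
h(u), with an error controlled by `pairSum`. This error is exponentially small away from the lines
on which ⟨z, a - b⟩ = 0, so its mean over |z| = t is O(1/t). By Cauchy's formula
(`circleAverage_supportFun`) the mean of h over the unit circle is l(f)/π. Hence M_S(t+1) - M_S(t) =
l(f)/π + O(1/t) (`exists_circleAverage_log_absSum_sub`).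

It remains to compare M_f with M_S. Since |f| ≤ S, always M_f ≤ M_S. Conversely, outside strips of
fixed width around those lines one term dominates, and log S - log|f| is O(`pairSum`). Inside the
strips f may vanish, but the area integral of log S - log|f| over their part of an annulus of width
one is bounded, so some circle in the annulus satisfies M_f(t) ≥ M_S(t) - O(1/t)
(`exists_radius_circleAverage_ge`). Jensen's bounds on [t-1, t] and [t, t+1] need the lower bound
for M_f at t only; at t ± 1 the inequality M_f ≤ M_S suffices. Monotonicity of N then passes from
these radii to all others. -/

namespace ExponentialSum

/-! ### Pointwise comparison of the exponential sum with its dominant term -/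

/-- The sum of the absolute values of the terms of an exponential sum. -/
noncomputable def absSum (Λ : Finset ℂ) (c : ℂ → ℂ) (z : ℂ) : ℝ :=
  ∑ a ∈ Λ, ‖c a‖ * Real.exp (inner ℝ z a)

/-- A sum which is small exactly where all terms of an exponential sum with spectrum `Λ` have
very different sizes. -/
noncomputable def pairSum (Λ : Finset ℂ) (z : ℂ) : ℝ :=
  ∑ p ∈ Λ.offDiag, Real.exp (-|inner ℝ z (p.1 - p.2)|)

/-- The support function of the spectrum. -/
noncomputable def supportFun (Λ : Finset ℂ) (hΛ : Λ.Nonempty) (z : ℂ) : ℝ :=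
  Λ.sup' hΛ (fun a => inner ℝ z a)

variable {Λ : Finset ℂ} {c : ℂ → ℂ}

theorem norm_term (a z w : ℂ) :
    ‖w * Complex.exp ((starRingEnd ℂ) a * z)‖ = ‖w‖ * Real.exp (inner ℝ z a) := by
  rw [norm_mul, Complex.norm_exp, real_inner_comm, Complex.inner, mul_comm z]

theorem norm_expSum_le (Λ : Finset ℂ) (c : ℂ → ℂ) (z : ℂ) :
    ‖expSum Λ c z‖ ≤ absSum Λ c z := by
  refine (norm_sum_le _ _).trans (le_of_eq ?_)
  exact Finset.sum_congr rfl fun a _ => norm_term a z _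

theorem absSum_pos (hΛ : Λ.Nonempty) (hc : ∀ a ∈ Λ, c a ≠ 0) (z : ℂ) : 0 < absSum Λ c z :=
  Finset.sum_pos (fun a ha => mul_pos (norm_pos_iff.2 (hc a ha)) (Real.exp_pos _)) hΛ

theorem pairSum_nonneg (Λ : Finset ℂ) (z : ℂ) : 0 ≤ pairSum Λ z :=
  Finset.sum_nonneg fun _ _ => (Real.exp_pos _).le

theorem continuous_absSum (Λ : Finset ℂ) (c : ℂ → ℂ) : Continuous (absSum Λ c) := by
  unfold absSum
  fun_prop

theorem continuous_pairSum (Λ : Finset ℂ) : Continuous (pairSum Λ) := by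
  unfold pairSum
  fun_prop

theorem continuous_supportFun (hΛ : Λ.Nonempty) : Continuous (supportFun Λ hΛ) := by
  unfold supportFun
  exact Continuous.finset_sup'_apply hΛ fun a _ => by fun_prop

theorem differentiable_expSum (Λ : Finset ℂ) (c : ℂ → ℂ) : Differentiable ℂ (expSum Λ c) := by
  unfold expSum
  fun_prop

theorem exists_coeff_bounds (hΛ : Λ.Nonempty) (hc : ∀ a ∈ Λ, c a ≠ 0) :
    ∃ m B : ℝ, 0 < m ∧ 0 < B ∧ ∀ a ∈ Λ, m ≤ ‖c a‖ ∧ ‖c a‖ ≤ B := by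
  obtain ⟨p, hp, hpm⟩ := Λ.exists_min_image (fun a => ‖c a‖) hΛ
  obtain ⟨q, hq, hqm⟩ := Λ.exists_max_image (fun a => ‖c a‖) hΛ
  exact ⟨‖c p‖, ‖c q‖, norm_pos_iff.2 (hc p hp), norm_pos_iff.2 (hc q hq),
    fun a ha => ⟨hpm a ha, hqm a ha⟩⟩

theorem sum_erase_le_pairSum {a : ℂ} (ha : a ∈ Λ) (z : ℂ) :
    ∑ b ∈ Λ.erase a, Real.exp (-|inner ℝ z (a - b)|) ≤ pairSum Λ z := by
  have hinj : Set.InjOn (fun b : ℂ => (a, b)) (Λ.erase a : Set ℂ) := fun x _ y _ h => by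
    simpa using h
  have h := Finset.sum_image (s := Λ.erase a) (g := fun b : ℂ => (a, b))
    (f := fun p : ℂ × ℂ => Real.exp (-|inner ℝ z (p.1 - p.2)|)) hinj
  rw [← h]
  refine Finset.sum_le_sum_of_subset_of_nonneg ?_ fun _ _ _ => (Real.exp_pos _).le
  intro p hp
  obtain ⟨b, hb, rfl⟩ := Finset.mem_image.1 hp
  simp only [Finset.mem_erase] at hb
  simp [ha, hb.2, Ne.symm hb.1]

/-- If a maximises ⟨z, ·⟩ on Λ, then ⟨z, b⟩ = ⟨z, a⟩ - |⟨z, a - b⟩|, so every other term is the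
dominant one times a summand of `pairSum`, up to the ratio of coefficients. -/
theorem sum_erase_le {m B : ℝ} (hm : 0 < m) (hmB : ∀ a ∈ Λ, m ≤ ‖c a‖ ∧ ‖c a‖ ≤ B)
    {a z : ℂ} (ha : a ∈ Λ) (hmax : ∀ b ∈ Λ, inner ℝ z b ≤ inner ℝ z a) :
    ∑ b ∈ Λ.erase a, ‖c b‖ * Real.exp (inner ℝ z b) ≤
      B / m * pairSum Λ z * (‖c a‖ * Real.exp (inner ℝ z a)) := by
  have hB : 0 ≤ B := hm.le.trans ((hmB a ha).1.trans (hmB a ha).2)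
  have key : ∀ b ∈ Λ.erase a, ‖c b‖ * Real.exp (inner ℝ z b) ≤
      B * Real.exp (-|inner ℝ z (a - b)|) * Real.exp (inner ℝ z a) := by
    intro b hb
    have hbΛ := Finset.mem_of_mem_erase hb
    rw [mul_assoc, ← Real.exp_add, inner_sub_right, abs_of_nonneg (sub_nonneg.2 (hmax b hbΛ))]
    refine mul_le_mul (hmB b hbΛ).2 (le_of_eq ?_) (Real.exp_pos _).le hB
    congr 1
    ring
  calc _ ≤ ∑ b ∈ Λ.erase a, B * Real.exp (-|inner ℝ z (a - b)|) * Real.exp (inner ℝ z a) :=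
        Finset.sum_le_sum key
    _ = B * (∑ b ∈ Λ.erase a, Real.exp (-|inner ℝ z (a - b)|)) * Real.exp (inner ℝ z a) := by
        rw [Finset.mul_sum, Finset.sum_mul]
    _ ≤ B * pairSum Λ z * Real.exp (inner ℝ z a) := by
        gcongr
        exact sum_erase_le_pairSum ha z
    _ = B / m * pairSum Λ z * (m * Real.exp (inner ℝ z a)) := by
        field_simp
    _ ≤ _ := by
        have := pairSum_nonneg Λ z
        gcongr
        exact (hmB a ha).1

theorem log_div_le_of_le_half {x : ℝ} (h0 : 0 ≤ x) (h1 : x ≤ 1 / 2) :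
    Real.log (1 + x) - Real.log (1 - x) ≤ 4 * x := by
  have h3 : 0 < 1 - x := by linarith
  rw [← Real.log_div (by linarith) h3.ne']
  refine (Real.log_le_sub_one_of_pos (by positivity)).trans ?_
  rw [div_sub_one h3.ne', div_le_iff₀ h3]
  nlinarith

/-- Where all terms have very different sizes, an exponential sum is comparable to the sum of
the absolute values of its terms. -/
theorem exists_log_absSum_sub_le (hΛ : Λ.Nonempty) (hc : ∀ a ∈ Λ, c a ≠ 0) :
    ∃ K C : ℝ, 0 < K ∧ 0 ≤ C ∧ ∀ z, (∀ p ∈ Λ.offDiag, K ≤ |inner ℝ z (p.1 - p.2)|) →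
      expSum Λ c z ≠ 0 ∧
      Real.log (absSum Λ c z) - Real.log ‖expSum Λ c z‖ ≤ C * pairSum Λ z := by
  obtain ⟨m, B, hm, hB, hmB⟩ := exists_coeff_bounds hΛ hc
  set N : ℝ := (Λ.offDiag.card : ℝ) + 1 with hN
  have hN0 : 0 < N := by positivity
  -- Since exp K ≥ K, each summand of `pairSum` is at most 1/K, which makes x ≤ 1/2 below. The + 1
  -- in N keeps K positive when Λ is a single point.
  refine ⟨2 * (B / m) * N, 4 * (B / m), by positivity, by positivity, fun z hz => ?_⟩
  obtain ⟨a, ha, hmax⟩ := Λ.exists_max_image (fun a => (inner ℝ z a : ℝ)) hΛ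
  set T := ‖c a‖ * Real.exp (inner ℝ z a) with hT
  have hT0 : 0 < T := mul_pos (hm.trans_le (hmB a ha).1) (Real.exp_pos _)
  set x := B / m * pairSum Λ z with hx
  have hx0 : 0 ≤ x := mul_nonneg (by positivity) (pairSum_nonneg _ _)
  have hx1 : x ≤ 1 / 2 := by
    have h1 : pairSum Λ z ≤ Λ.offDiag.card • (1 / (2 * (B / m) * N)) := by
      refine Finset.sum_le_card_nsmul _ _ _ fun p hp => ?_
      rw [Real.exp_neg, ← one_div]
      refine one_div_le_one_div_of_le (by positivity) ?_
      exact (hz p hp).trans ((le_add_of_nonneg_right zero_le_one).trans (Real.add_one_le_exp _))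
    rw [nsmul_eq_mul] at h1
    calc x ≤ B / m * (Λ.offDiag.card * (1 / (2 * (B / m) * N))) := by
          rw [hx]; gcongr
      _ = Λ.offDiag.card / (2 * N) := by field_simp
      _ ≤ 1 / 2 := by
          rw [div_le_div_iff₀ (by positivity) (by norm_num), hN]
          linarith
  have hrest := sum_erase_le hm hmB ha hmax
  rw [← hx, ← hT] at hrest
  have hS : absSum Λ c z ≤ T * (1 + x) := by
    rw [absSum, ← Finset.add_sum_erase _ _ ha]
    linarith
  have hf : T * (1 - x) ≤ ‖expSum Λ c z‖ := by
    rw [expSum, ← Finset.add_sum_erase _ _ ha]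
    refine le_trans ?_ (norm_sub_le_norm_add _ _)
    rw [norm_term]
    have h2 : ‖∑ b ∈ Λ.erase a, c b * Complex.exp ((starRingEnd ℂ) b * z)‖ ≤ x * T := by
      refine (norm_sum_le _ _).trans (le_trans (le_of_eq ?_) hrest)
      exact Finset.sum_congr rfl fun b _ => norm_term b z _
    linarith
  have hpos : 0 < T * (1 - x) := mul_pos hT0 (by linarith)
  refine ⟨norm_pos_iff.1 (hpos.trans_le hf), ?_⟩
  have h3 := Real.log_le_log (absSum_pos hΛ hc z) hS
  have h4 := Real.log_le_log hpos hf
  rw [Real.log_mul hT0.ne' (by linarith)] at h3 h4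
  have h5 := log_div_le_of_le_half hx0 hx1
  have h6 : 4 * x = 4 * (B / m) * pairSum Λ z := by rw [hx]; ring
  linarith

/-- Along a ray, the logarithm of the sum of absolute values grows like the support function. -/
theorem exists_log_absSum_ray (hΛ : Λ.Nonempty) (hc : ∀ a ∈ Λ, c a ≠ 0) :
    ∃ C : ℝ, 0 ≤ C ∧ ∀ (u : ℂ) (s t : ℝ), 0 ≤ s → s ≤ t →
      Real.log (absSum Λ c (t * u)) - Real.log (absSum Λ c (s * u)) ≤ (t - s) * supportFun Λ hΛ u ∧
      (t - s) * supportFun Λ hΛ u - C * pairSum Λ (s * u) ≤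
        Real.log (absSum Λ c (t * u)) - Real.log (absSum Λ c (s * u)) := by
  obtain ⟨m, B, hm, hB, hmB⟩ := exists_coeff_bounds hΛ hc
  refine ⟨B / m, by positivity, fun u s t hs hst => ?_⟩
  have hin : ∀ (r : ℝ) (a : ℂ), inner ℝ ((r : ℂ) * u) a = r * inner ℝ u a := fun r a => by
    rw [← Complex.real_smul, real_inner_smul_left]
  have hle : ∀ a ∈ Λ, inner ℝ u a ≤ supportFun Λ hΛ u := fun a ha =>
    Finset.le_sup' (fun a => (inner ℝ u a : ℝ)) ha
  obtain ⟨a, ha, hmax⟩ := Λ.exists_max_image (fun a => (inner ℝ u a : ℝ)) hΛ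
  have hsup : supportFun Λ hΛ u = inner ℝ u a :=
    le_antisymm (Finset.sup'_le hΛ _ hmax) (hle a ha)
  have hSs := absSum_pos hΛ hc ((s : ℂ) * u)
  have hSt := absSum_pos hΛ hc ((t : ℂ) * u)
  set E := Real.exp ((t - s) * supportFun Λ hΛ u) with hE
  have hE0 : 0 < E := Real.exp_pos _
  constructor
  · have h1 : absSum Λ c (t * u) ≤ E * absSum Λ c (s * u) := by
      rw [absSum, absSum, Finset.mul_sum]
      refine Finset.sum_le_sum fun b hb => ?_
      rw [hin, hin, mul_left_comm, hE, ← Real.exp_add]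
      gcongr
      have := mul_le_mul_of_nonneg_left (hle b hb) (sub_nonneg.2 hst)
      linarith
    have h2 := Real.log_le_log hSt h1
    rw [Real.log_mul hE0.ne' hSs.ne', hE, Real.log_exp] at h2
    linarith
  · set T := ‖c a‖ * Real.exp (inner ℝ ((s : ℂ) * u) a) with hT
    have hT0 : 0 < T := mul_pos (hm.trans_le (hmB a ha).1) (Real.exp_pos _)
    have hrest := sum_erase_le (z := (s : ℂ) * u) hm hmB ha fun b hb => by
      rw [hin, hin]; exact mul_le_mul_of_nonneg_left (hmax b hb) hs
    rw [← hT] at hrest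
    have h1 : absSum Λ c (s * u) ≤ T * (1 + B / m * pairSum Λ (s * u)) := by
      rw [absSum, ← Finset.add_sum_erase _ _ ha]
      linarith
    have h2 : E * T ≤ absSum Λ c (t * u) := by
      rw [absSum, ← Finset.add_sum_erase _ _ ha]
      refine le_trans (le_of_eq ?_) (le_add_of_nonneg_right
        (Finset.sum_nonneg fun _ _ => by positivity))
      rw [hE, hT, hsup, mul_left_comm, ← Real.exp_add, hin, hin]
      congr 2
      ring
    have hx0 : 0 ≤ B / m * pairSum Λ (s * u) :=
      mul_nonneg (by positivity) (pairSum_nonneg _ _)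
    have h3 := Real.log_le_log hSs h1
    have h4 := Real.log_le_log (by positivity) h2
    rw [Real.log_mul hT0.ne' (by positivity)] at h3
    rw [Real.log_mul hE0.ne' hT0.ne', hE, Real.log_exp] at h4
    have h5 := Real.log_le_sub_one_of_pos (x := 1 + B / m * pairSum Λ (s * u)) (by positivity)
    linarith

/-- The logarithm of `absSum` is Lipschitz. This controls it on a disk of fixed radius by its value
at the centre, uniformly in the position of the disk. -/
theorem absSum_le_mul_exp (Λ : Finset ℂ) (c : ℂ → ℂ) (z w : ℂ) :
    absSum Λ c w ≤ absSum Λ c z * Real.exp ((∑ a ∈ Λ, ‖a‖) * ‖w - z‖) := by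
  rw [absSum, absSum, Finset.sum_mul]
  refine Finset.sum_le_sum fun a ha => ?_
  rw [mul_assoc, ← Real.exp_add]
  gcongr
  have h1 : inner ℝ w a = inner ℝ z a + inner ℝ (w - z) a := by rw [inner_sub_left]; ring
  have h2 := real_inner_le_norm (w - z) a
  have h3 : ‖a‖ ≤ ∑ a ∈ Λ, ‖a‖ := Finset.single_le_sum (fun a _ => norm_nonneg a) ha
  have h4 := mul_le_mul_of_nonneg_left h3 (norm_nonneg (w - z))
  linarith

/-- Every point is within bounded distance of a point outside finitely many given strips through
the origin. -/
theorem exists_dist_le_forall_le_abs_inner {ι : Type*} (s : Finset ι) (d : ι → ℂ)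
    (hd : ∀ i ∈ s, d i ≠ 0) (K : ℝ) (hK : 0 ≤ K) :
    ∃ R : ℝ, 0 ≤ R ∧ ∀ z : ℂ, ∃ w, ‖w - z‖ ≤ R ∧ ∀ i ∈ s, K ≤ |inner ℝ w (d i)| := by
  classical
  induction s using Finset.induction_on generalizing K with
  | empty => exact ⟨0, le_rfl, fun z => ⟨z, by simp⟩⟩
  | insert j s hj ih =>
    have hdj : 0 < ‖d j‖ := norm_pos_iff.2 (hd j (Finset.mem_insert_self _ _))
    set δ := K / ‖d j‖ with hδ
    have hδ0 : 0 ≤ δ := by positivity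
    have hsum0 : 0 ≤ ∑ i ∈ s, ‖d i‖ := Finset.sum_nonneg fun i _ => norm_nonneg _
    -- The margin for the earlier strips is enlarged by the most that the coming shift, of length δ,
    -- can change the earlier inner products.
    obtain ⟨R, hR0, hR⟩ := ih (fun i hi => hd i (Finset.mem_insert_of_mem hi))
      (K + δ * ∑ i ∈ s, ‖d i‖) (by positivity)
    refine ⟨R + δ, by positivity, fun z => ?_⟩
    obtain ⟨w, hw, hwi⟩ := hR z
    -- The sign makes the shift along `d j` lead away from the centre line of the new strip.
    obtain ⟨ε, hε, hε'⟩ : ∃ ε : ℝ, |ε| = 1 ∧ 0 ≤ ε * inner ℝ w (d j) := by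
      rcases le_total 0 (inner ℝ w (d j) : ℝ) with h | h
      · exact ⟨1, by simp, by simpa using h⟩
      · exact ⟨-1, by simp, by linarith⟩
    set v : ℂ := (ε * (δ / ‖d j‖)) • d j with hv
    have hvn : ‖v‖ = δ := by
      rw [hv, norm_smul, Real.norm_eq_abs, abs_mul, hε, one_mul, abs_of_nonneg (by positivity)]
      field_simp
    refine ⟨w + v, ?_, fun i hi => ?_⟩
    · calc ‖w + v - z‖ = ‖(w - z) + v‖ := by ring_nf
        _ ≤ R + δ := (norm_add_le _ _).trans (by rw [hvn]; linarith)
    · rw [inner_add_left]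
      rcases Finset.mem_insert.1 hi with rfl | hi
      · have h1 : inner ℝ v (d i) = ε * K := by
          rw [hv, real_inner_smul_left, real_inner_self_eq_norm_sq, hδ]
          field_simp
        have h2 : ε * ε = 1 := by rw [← abs_mul_abs_self, hε, one_mul]
        have h3 : |inner ℝ w (d i) + inner ℝ v (d i)| =
            |ε * (inner ℝ w (d i) + inner ℝ v (d i))| := by rw [abs_mul, hε, one_mul]
        rw [h3, h1]
        refine le_trans ?_ (le_abs_self _)
        nlinarith
      · have h1 := hwi i hi
        have h2 : |inner ℝ v (d i)| ≤ δ * ∑ i ∈ s, ‖d i‖ := by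
          refine (abs_real_inner_le_norm _ _).trans ?_
          rw [hvn]
          exact mul_le_mul_of_nonneg_left
            (Finset.single_le_sum (f := fun i => ‖d i‖) (fun i _ => norm_nonneg _) hi) hδ0
        have h3 := abs_sub_abs_le_abs_sub (inner ℝ w (d i) : ℝ) (-inner ℝ v (d i))
        rw [abs_neg, sub_neg_eq_add] at h3
        linarith

end ExponentialSum

/-! ### Circle averages of `pairSum` -/

namespace ExponentialSum

open intervalIntegral in
-- Jordan's inequality sin x ≥ 2x/π on [0, π/2], used from both ends of [0, π], bounds the integrand
-- by two decaying exponentials of rate k = 2s/π.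
theorem integral_exp_neg_mul_abs_sin_le {s : ℝ} (hs : 0 < s) :
    ∫ x in (0 : ℝ)..(2 * Real.pi), Real.exp (-(s * |Real.sin x|)) ≤ 2 * Real.pi / s := by
  have hpi := Real.pi_pos
  have hc : Continuous fun x : ℝ => Real.exp (-(s * |Real.sin x|)) := by fun_prop
  have hper : Function.Periodic (fun x : ℝ => Real.exp (-(s * |Real.sin x|))) Real.pi := fun x => by
    simp [Real.sin_add_pi]
  have hsplit : ∫ x in (0 : ℝ)..(2 * Real.pi), Real.exp (-(s * |Real.sin x|)) =
      2 * ∫ x in (0 : ℝ)..Real.pi, Real.exp (-(s * |Real.sin x|)) := by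
    rw [← integral_add_adjacent_intervals (hc.intervalIntegrable 0 Real.pi)
      (hc.intervalIntegrable Real.pi _)]
    have := hper.intervalIntegral_add_eq Real.pi 0
    rw [zero_add, ← two_mul] at this
    rw [this, two_mul]
  set k := 2 * s / Real.pi with hk
  have hk0 : 0 < k := by positivity
  have hexp : ∫ x in (0 : ℝ)..Real.pi, Real.exp (-(k * x)) ≤ 1 / k := by
    have h : ∀ x ∈ Set.uIcc 0 Real.pi, HasDerivAt (fun x => -(1 / k) * Real.exp (-(k * x)))
        (Real.exp (-(k * x))) x := fun x _ => by
      have h1 : HasDerivAt (fun x => -(k * x)) (-(k * 1)) x := ((hasDerivAt_id x).const_mul k).neg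
      convert! (h1.exp.const_mul (-(1 / k))) using 1
      field_simp
    rw [integral_eq_sub_of_hasDerivAt h (Continuous.intervalIntegrable (by fun_prop) _ _)]
    have : 0 < 1 / k * Real.exp (-(k * Real.pi)) := by positivity
    simp
    simpa using this.le
  have hexp' : ∫ x in (0 : ℝ)..Real.pi, Real.exp (-(k * (Real.pi - x))) ≤ 1 / k := by
    rw [integral_comp_sub_left (fun x => Real.exp (-(k * x)))]
    simpa using hexp
  have hle : ∫ x in (0 : ℝ)..Real.pi, Real.exp (-(s * |Real.sin x|)) ≤
      ∫ x in (0 : ℝ)..Real.pi, (Real.exp (-(k * x)) + Real.exp (-(k * (Real.pi - x)))) := by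
    refine integral_mono_on hpi.le (hc.intervalIntegrable _ _)
      (Continuous.intervalIntegrable (by fun_prop) _ _) fun x hx => ?_
    rw [abs_of_nonneg (Real.sin_nonneg_of_mem_Icc hx)]
    rcases le_total x (Real.pi / 2) with h | h
    · refine le_trans ?_ (le_add_of_nonneg_right (Real.exp_pos _).le)
      have := mul_le_mul_of_nonneg_left (Real.mul_le_sin hx.1 h) hs.le
      refine Real.exp_le_exp.2 (neg_le_neg (le_trans (le_of_eq ?_) this))
      rw [hk]; ring
    · refine le_trans ?_ (le_add_of_nonneg_left (Real.exp_pos _).le)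
      have h1 := Real.mul_le_sin (x := Real.pi - x) (by linarith [hx.2]) (by linarith)
      rw [Real.sin_pi_sub] at h1
      have := mul_le_mul_of_nonneg_left h1 hs.le
      refine Real.exp_le_exp.2 (neg_le_neg (le_trans (le_of_eq ?_) this))
      rw [hk]; ring
  rw [integral_add (Continuous.intervalIntegrable (by fun_prop) _ _)
    (Continuous.intervalIntegrable (by fun_prop) _ _)] at hle
  have h2 : 2 * (1 / k + 1 / k) = 2 * Real.pi / s := by rw [hk]; field_simp; ring
  rw [hsplit]
  linarith

theorem inner_circleMap (t θ : ℝ) (d : ℂ) :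
    inner ℝ (circleMap 0 t θ) d = t * ‖d‖ * Real.cos (θ - d.arg) := by
  rw [Complex.inner, circleMap_zero]
  conv_lhs => rw [← Complex.norm_mul_exp_arg_mul_I d]
  rw [map_mul, ← Complex.exp_conj, Complex.conj_ofReal, map_mul, Complex.conj_I,
    Complex.conj_ofReal]
  have : (‖d‖ : ℂ) * Complex.exp (d.arg * Complex.I) * (t * Complex.exp (θ * -Complex.I)) =
      ((t * ‖d‖ : ℝ) : ℂ) * Complex.exp (((d.arg - θ : ℝ) : ℂ) * Complex.I) := by
    push_cast
    rw [sub_mul, sub_eq_add_neg, Complex.exp_add, mul_neg]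
    ring
  rw [this, Complex.re_ofReal_mul, Complex.exp_ofReal_mul_I_re, ← Real.cos_neg]
  simp

/-- On the circle ⟨z, d⟩ = t‖d‖ cos(θ - arg d); a translation of θ turns the cosine into a sine, and
periodicity restores the interval. -/
theorem circleAverage_exp_neg_abs_inner_le {d : ℂ} (hd : d ≠ 0) {t : ℝ} (ht : 0 < t) :
    Real.circleAverage (fun z => Real.exp (-|inner ℝ z d|)) 0 t ≤ 1 / ‖d‖ / t := by
  have hd0 : 0 < ‖d‖ := norm_pos_iff.2 hd
  have hper : Function.Periodic (fun x : ℝ => Real.exp (-(t * ‖d‖ * |Real.sin x|)))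
      (2 * Real.pi) := fun x => by simp
  have h : ∀ θ, Real.exp (-|inner ℝ (circleMap 0 t θ) d|) =
      Real.exp (-(t * ‖d‖ * |Real.sin (θ - (d.arg - Real.pi / 2))|)) := fun θ => by
    rw [inner_circleMap, abs_mul, abs_of_pos (by positivity),
      show θ - (d.arg - Real.pi / 2) = θ - d.arg + Real.pi / 2 by ring, Real.sin_add_pi_div_two]
  rw [Real.circleAverage_def]
  simp only [h]
  rw [intervalIntegral.integral_comp_sub_right
    (fun x => Real.exp (-(t * ‖d‖ * |Real.sin x|)))]
  have h1 := hper.intervalIntegral_add_eq (0 - (d.arg - Real.pi / 2)) 0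
  rw [show 0 - (d.arg - Real.pi / 2) + 2 * Real.pi = 2 * Real.pi - (d.arg - Real.pi / 2) by ring,
    zero_add] at h1
  rw [h1, smul_eq_mul]
  have h2 := integral_exp_neg_mul_abs_sin_le (s := t * ‖d‖) (by positivity)
  calc _ ≤ (2 * Real.pi)⁻¹ * (2 * Real.pi / (t * ‖d‖)) := by gcongr
    _ = _ := by field_simp

theorem exists_circleAverage_pairSum_le (Λ : Finset ℂ) :
    ∃ C : ℝ, 0 ≤ C ∧ ∀ t : ℝ, 0 < t → Real.circleAverage (pairSum Λ) 0 t ≤ C / t := by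
  refine ⟨∑ p ∈ Λ.offDiag, 1 / ‖p.1 - p.2‖, Finset.sum_nonneg fun _ _ => by positivity,
    fun t ht => ?_⟩
  have h : pairSum Λ = ∑ p ∈ Λ.offDiag, fun z => Real.exp (-|inner ℝ z (p.1 - p.2)|) := by
    ext z
    simp [pairSum]
  rw [h, Real.circleAverage_sum, Finset.sum_div]
  · refine Finset.sum_le_sum fun p hp => ?_
    exact circleAverage_exp_neg_abs_inner_le (sub_ne_zero.2 (Finset.mem_offDiag.1 hp).2.2) ht
  · intro p _
    exact (Continuous.continuousOn (by fun_prop)).circleIntegrable'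

end ExponentialSum

/-! ### Jensen's formula and the zero count -/

namespace ExponentialSum

open MeromorphicOn Metric

theorem analyticOrderAt_ne_top {f : ℂ → ℂ} (hf : Differentiable ℂ f) {w : ℂ} (hw : f w ≠ 0)
    (z : ℂ) : analyticOrderAt f z ≠ ⊤ := by
  have hfa : AnalyticOnNhd ℂ f Set.univ := fun z _ => hf.analyticAt z
  intro h
  rw [analyticOrderAt_eq_top] at h
  exact hw (hfa.eqOn_zero_of_preconnected_of_eventuallyEq_zero isPreconnected_univ
    (Set.mem_univ z) h (Set.mem_univ w))

theorem divisor_closedBall {f : ℂ → ℂ} (hf : Differentiable ℂ f) {w : ℂ} (hw : f w ≠ 0)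
    (c z : ℂ) (t : ℝ) :
    divisor f (closedBall c t) z = if ‖z - c‖ ≤ t then (analyticOrderNatAt f z : ℤ) else 0 := by
  have hfa : AnalyticOnNhd ℂ f (closedBall c t) := fun z _ => hf.analyticAt z
  split_ifs with h
  · rw [hfa.divisor_apply (mem_closedBall_iff_norm.2 h), ← Nat.cast_analyticOrderNatAt (analyticOrderAt_ne_top hf hw z)]
    rfl
  · exact Function.locallyFinsuppWithin.apply_eq_zero_of_notMem _ (mt mem_closedBall_iff_norm.1 h)

theorem analyticOrderNatAt_ne_zero_iff {f : ℂ → ℂ} (hf : Differentiable ℂ f) {w : ℂ}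
    (hw : f w ≠ 0) (z : ℂ) : analyticOrderNatAt f z ≠ 0 ↔ f z = 0 := by
  rw [Ne, ← Nat.cast_inj (R := ℕ∞), Nat.cast_analyticOrderNatAt (analyticOrderAt_ne_top hf hw z)]
  exact (hf.analyticAt z).analyticOrderAt_ne_zero

theorem finite_zeros {f : ℂ → ℂ} (hf : Differentiable ℂ f) {w : ℂ} (hw : f w ≠ 0) (r : ℝ) :
    {z : ℂ | z ∈ closedBall (0 : ℂ) r ∧ f z = 0}.Finite := by
  refine ((divisor f (closedBall 0 r)).finiteSupport (isCompact_closedBall 0 r)).subset ?_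
  rintro z ⟨hz, h0⟩
  rw [Function.mem_support, divisor_closedBall hf hw, if_pos (mem_closedBall_iff_norm.1 hz)]
  exact_mod_cast (analyticOrderNatAt_ne_zero_iff hf hw z).2 h0

/-- One index set serves all radii t ≤ r, so that counts at two radii can be compared term by term.
-/
theorem zeroCount_eq_sum {f : ℂ → ℂ} (hf : Differentiable ℂ f) {w : ℂ} (hw : f w ≠ 0)
    {r t : ℝ} (htr : t ≤ r) :
    zeroCount f t = ∑ u ∈ (finite_zeros hf hw r).toFinset,
      if ‖u‖ ≤ t then analyticOrderNatAt f u else 0 := by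
  have h : ∀ u, (∑ᶠ _ : u ∈ closedBall (0 : ℂ) t, analyticOrderNatAt f u) =
      if ‖u‖ ≤ t then analyticOrderNatAt f u else 0 := fun u => by
    simp [finsum_eq_if]
  rw [zeroCount, finsum_congr h]
  refine finsum_eq_sum_of_support_subset _ fun u hu => ?_
  simp only [Function.mem_support, ne_eq, ite_eq_right_iff, Classical.not_imp] at hu
  simp only [Set.Finite.coe_toFinset, Set.mem_ofPred_eq, mem_closedBall, dist_zero_right]
  exact ⟨hu.1.trans htr, (analyticOrderNatAt_ne_zero_iff hf hw u).1 hu.2⟩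

/-- Jensen's formula, with the contribution of a zero at the origin folded into the sum. The
trailing coefficient does not depend on t and cancels in differences. -/
theorem circleAverage_log_norm_eq_sum {f : ℂ → ℂ} (hf : Differentiable ℂ f) {w : ℂ}
    (hw : f w ≠ 0) {r t : ℝ} (ht : 0 < t) (htr : t ≤ r) :
    Real.circleAverage (fun z => Real.log ‖f z‖) 0 t =
      (∑ u ∈ (finite_zeros hf hw r).toFinset,
        (if ‖u‖ ≤ t then (analyticOrderNatAt f u : ℝ) else 0) *
          Real.log (if u = 0 then t else t * ‖u‖⁻¹)) +
      Real.log ‖meromorphicTrailingCoeffAt f 0‖ := by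
  have hfm : MeromorphicOn f (closedBall 0 |t|) := fun z _ => (hf.analyticAt z).meromorphicAt
  rw [MeromorphicOn.circleAverage_log_norm ht.ne' hfm, abs_of_pos ht]
  congr 1
  have h0 : (0 : ℂ) ∈ closedBall (0 : ℂ) t := by simpa using ht.le
  have hterm : ∀ u, (divisor f (closedBall 0 t) u : ℝ) =
      if ‖u‖ ≤ t then (analyticOrderNatAt f u : ℝ) else 0 := fun u => by
    rw [divisor_closedBall hf hw]
    simp only [sub_zero]
    split_ifs <;> simp
  have hsub : ∀ g : ℂ → ℝ, (Function.support fun u =>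
      (if ‖u‖ ≤ t then (analyticOrderNatAt f u : ℝ) else 0) * g u) ⊆
      ((finite_zeros hf hw r).toFinset : Set ℂ) := fun g u hu => by
    have h1 := left_ne_zero_of_mul hu
    simp only [ne_eq, ite_eq_right_iff, Classical.not_imp, Nat.cast_eq_zero] at h1
    simp only [Set.Finite.coe_toFinset, Set.mem_ofPred_eq, mem_closedBall, dist_zero_right]
    exact ⟨h1.1.trans htr, (analyticOrderNatAt_ne_zero_iff hf hw u).1 h1.2⟩
  simp only [hterm]
  rw [finsum_eq_sum_of_support_subset _ (hsub _)]
  have hzero : (if ‖(0 : ℂ)‖ ≤ t then (analyticOrderNatAt f 0 : ℝ) else 0) * Real.log t =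
      ∑ u ∈ (finite_zeros hf hw r).toFinset,
        if u = 0 then (if ‖u‖ ≤ t then (analyticOrderNatAt f u : ℝ) else 0) * Real.log t else 0 := by
    rw [Finset.sum_ite_eq']
    split_ifs with h1 h2 h2
    · rfl
    · simp at h1 ⊢
      left
      by_contra h3
      apply h2
      simp [ht.le.trans htr, (analyticOrderNatAt_ne_zero_iff hf hw 0).1 h3]
    · simp
    · simp
  rw [hzero, ← Finset.sum_add_distrib]
  refine Finset.sum_congr rfl fun u _ => ?_
  by_cases hu : u = 0
  · simp [hu]
  · simp [hu]

/-- Jensen's formula bounds the growth of circle averages below by numbers of zeros. -/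
theorem zeroCount_mul_log_le {f : ℂ → ℂ} (hf : Differentiable ℂ f) {w : ℂ} (hw : f w ≠ 0)
    {s t : ℝ} (hs : 0 < s) (hst : s ≤ t) :
    zeroCount f s * (Real.log t - Real.log s) ≤
      Real.circleAverage (fun z => Real.log ‖f z‖) 0 t -
        Real.circleAverage (fun z => Real.log ‖f z‖) 0 s := by
  rw [circleAverage_log_norm_eq_sum hf hw (hs.trans_le hst) le_rfl,
    circleAverage_log_norm_eq_sum hf hw hs hst, zeroCount_eq_sum hf hw hst,
    add_sub_add_right_eq_sub, ← Finset.sum_sub_distrib, Nat.cast_sum, Finset.sum_mul]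
  -- A zero with |u| ≤ s contributes exactly log(t/s) to the difference, one with s < |u| ≤ t
  -- contributes log(t/|u|) ≥ 0.
  refine Finset.sum_le_sum fun u hu => ?_
  have hut : ‖u‖ ≤ t := by simpa using ((Set.Finite.mem_toFinset _).1 hu).1
  have ht := hs.trans_le hst
  rw [if_pos hut]
  by_cases h0 : u = 0
  · simp [h0, hs.le, mul_sub]
  · have hu0 : ‖u‖⁻¹ ≠ 0 := inv_ne_zero (norm_ne_zero_iff.2 h0)
    simp only [h0, if_false]
    split_ifs with h
    · rw [Real.log_mul ht.ne' hu0, Real.log_mul hs.ne' hu0]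
      exact le_of_eq (by ring)
    · have h2 : 1 ≤ t * ‖u‖⁻¹ := by
        rw [← div_eq_mul_inv, one_le_div (norm_pos_iff.2 h0)]; exact hut
      have := Real.log_nonneg h2
      simp only [Nat.cast_zero, zero_mul, sub_zero]
      positivity

/-- Jensen's formula bounds the growth of circle averages above by numbers of zeros. -/
theorem le_zeroCount_mul_log {f : ℂ → ℂ} (hf : Differentiable ℂ f) {w : ℂ} (hw : f w ≠ 0)
    {s t : ℝ} (hs : 0 < s) (hst : s ≤ t) :
    Real.circleAverage (fun z => Real.log ‖f z‖) 0 t -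
        Real.circleAverage (fun z => Real.log ‖f z‖) 0 s ≤
      zeroCount f t * (Real.log t - Real.log s) := by
  rw [circleAverage_log_norm_eq_sum hf hw (hs.trans_le hst) le_rfl,
    circleAverage_log_norm_eq_sum hf hw hs hst, zeroCount_eq_sum hf hw le_rfl,
    add_sub_add_right_eq_sub, ← Finset.sum_sub_distrib, Nat.cast_sum, Finset.sum_mul]
  refine Finset.sum_le_sum fun u hu => ?_
  have hut : ‖u‖ ≤ t := by simpa using ((Set.Finite.mem_toFinset _).1 hu).1
  have ht := hs.trans_le hst
  rw [if_pos hut, if_pos hut]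
  by_cases h0 : u = 0
  · simp [h0, hs.le, mul_sub]
  · have hu0 : ‖u‖⁻¹ ≠ 0 := inv_ne_zero (norm_ne_zero_iff.2 h0)
    simp only [h0, if_false]
    split_ifs with h
    · rw [Real.log_mul ht.ne' hu0, Real.log_mul hs.ne' hu0]
      exact le_of_eq (by ring)
    · rw [zero_mul, sub_zero, Real.log_mul ht.ne' hu0, Real.log_inv, ← sub_eq_add_neg]
      gcongr
      exact (not_le.1 h).le

theorem zeroCount_mono {f : ℂ → ℂ} (hf : Differentiable ℂ f) {w : ℂ} (hw : f w ≠ 0) :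
    Monotone (zeroCount f) := by
  intro s t hst
  rw [zeroCount_eq_sum hf hw hst, zeroCount_eq_sum hf hw le_rfl]
  refine Finset.sum_le_sum fun u _ => ?_
  split_ifs with h1 h2 h2
  · rfl
  · exact absurd (h1.trans hst) h2
  · exact Nat.zero_le _
  · rfl

/-- Subharmonicity of log|f|: in Jensen's formula centred at c, every zero contributes a nonnegative
term. -/
theorem log_norm_le_circleAverage {f : ℂ → ℂ} (hf : Differentiable ℂ f) {c : ℂ} (hc : f c ≠ 0)
    {t : ℝ} (ht : 0 < t) :
    Real.log ‖f c‖ ≤ Real.circleAverage (fun z => Real.log ‖f z‖) c t := by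
  rw [AnalyticOnNhd.circleAverage_log_norm ht.ne' (fun z _ => hf.analyticAt z) hc, abs_of_pos ht]
  refine le_add_of_nonneg_left (finsum_nonneg fun u => ?_)
  rw [divisor_closedBall hf hc]
  split_ifs with h
  · refine mul_nonneg (by positivity) ?_
    rcases eq_or_ne u c with rfl | hu
    · simp
    · refine Real.log_nonneg ?_
      rw [norm_sub_rev] at h
      rw [← div_eq_mul_inv, one_le_div (norm_pos_iff.2 (sub_ne_zero.2 hu.symm))]
      exact h
  · simp

end ExponentialSum

/-! ### Area integrals of the logarithmic deficit and the choice of good circles -/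

namespace ExponentialSum

open MeasureTheory Metric Set

theorem circleAverage_eq_setIntegral (f : ℂ → ℝ) (c : ℂ) (t : ℝ) :
    Real.circleAverage f c t =
      (2 * Real.pi)⁻¹ * ∫ θ in Ioc (-Real.pi) Real.pi, f (circleMap c t θ) := by
  rw [Real.circleAverage_eq_integral_add (-Real.pi),
    intervalIntegral.integral_comp_add_right (fun θ => f (circleMap c t θ)), smul_eq_mul,
    intervalIntegral.integral_of_le (by linarith [Real.pi_pos])]
  congr 3
  congr 1 <;> ring

theorem integrableOn_of_circleIntegrable {f : ℂ → ℝ} {c : ℂ} {t : ℝ}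
    (hf : CircleIntegrable f c t) :
    IntegrableOn (fun θ => f (circleMap c t θ)) (Ioc (-Real.pi) Real.pi) := by
  have hper : Function.Periodic (fun θ => f (circleMap c t θ)) (2 * Real.pi) := fun x => by
    simp [periodic_circleMap c t x]
  have h := hper.intervalIntegrable₀ Real.two_pi_pos.ne' hf (-Real.pi) Real.pi
  exact (intervalIntegrable_iff_integrableOn_Ioc_of_le (by linarith [Real.pi_pos])).1 h

theorem lintegral_eq_lintegral_circleMap {F : ℂ → ENNReal} (hF : Measurable F) (c : ℂ) :
    ∫⁻ z, F z = ∫⁻ ρ in Ioi (0 : ℝ), ENNReal.ofReal ρ *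
      ∫⁻ θ in Ioc (-Real.pi) Real.pi, F (circleMap c ρ θ) := by
  have hmap : ∀ p : ℝ × ℝ, c + Complex.polarCoord.symm p = circleMap c p.1 p.2 := fun p => by
    rw [Complex.polarCoord_symm_apply, circleMap, Complex.exp_mul_I]
    push_cast
    rfl
  have hcm : Measurable fun p : ℝ × ℝ => circleMap c p.1 p.2 := by
    unfold circleMap
    fun_prop
  rw [← lintegral_add_left_eq_self F c, ← Complex.lintegral_comp_polarCoord_symm]
  simp only [hmap, smul_eq_mul]
  rw [polarCoord_target, Measure.volume_eq_prod, setLIntegral_prod]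
  · refine lintegral_congr fun ρ => ?_
    simp only
    rw [lintegral_const_mul, setLIntegral_congr Ioo_ae_eq_Ioc]
    exact hF.comp (hcm.comp measurable_prodMk_left)
  · exact Measurable.aemeasurable (by fun_prop)

theorem measurable_neg_log_norm {g : ℂ → ℂ} (hg : Differentiable ℂ g) :
    Measurable fun z => ENNReal.ofReal (-Real.log ‖g z‖) := by
  have := hg.continuous.measurable
  fun_prop

/-- The logarithm of an analytic function bounded by one is locally integrable, with a bound
depending on one value of the function only. -/
theorem setLIntegral_neg_log_norm_le {g : ℂ → ℂ} (hg : Differentiable ℂ g) {c : ℂ} {R : ℝ}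
    (hR : 0 < R) (hle : ∀ z ∈ ball c R, ‖g z‖ ≤ 1) (hc : g c ≠ 0) :
    ∫⁻ z in ball c R, ENNReal.ofReal (-Real.log ‖g z‖) ≤
      ENNReal.ofReal (R * R * (2 * Real.pi * (-Real.log ‖g c‖))) := by
  have hlc : 0 ≤ -Real.log ‖g c‖ :=
    neg_nonneg.2 (Real.log_nonpos (norm_nonneg _) (hle c (mem_ball_self hR)))
  rw [← lintegral_indicator measurableSet_ball, lintegral_eq_lintegral_circleMap
    ((measurable_neg_log_norm hg).indicator measurableSet_ball) c]
  -- On each circle of radius ρ < R the sub-mean value inequality bounds the angular integral by its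
  -- value at the centre; the radial factor ρ is bounded by R.
  have key : ∀ ρ ∈ Ioi (0 : ℝ), ENNReal.ofReal ρ * ∫⁻ θ in Ioc (-Real.pi) Real.pi,
      (ball c R).indicator (fun z => ENNReal.ofReal (-Real.log ‖g z‖)) (circleMap c ρ θ) ≤
      (Iio R).indicator (fun _ => ENNReal.ofReal (R * (2 * Real.pi * (-Real.log ‖g c‖)))) ρ := by
    intro ρ (hρ : 0 < ρ)
    have hdist : ∀ θ, dist (circleMap c ρ θ) c = ρ := fun θ => by
      rw [dist_eq_norm, circleMap_sub_center, norm_circleMap_zero, abs_of_pos hρ]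
    by_cases hρR : ρ < R
    · have hmem : ∀ θ, circleMap c ρ θ ∈ ball c R := fun θ => by
        rw [mem_ball, hdist]; exact hρR
      have hint : CircleIntegrable (fun z => Real.log ‖g z‖) c ρ :=
        MeromorphicOn.circleIntegrable_log_norm fun z _ => (hg.analyticAt z).meromorphicAt
      have hneg : IntegrableOn (fun θ => -Real.log ‖g (circleMap c ρ θ)‖)
          (Ioc (-Real.pi) Real.pi) := (integrableOn_of_circleIntegrable hint).neg
      rw [indicator_of_mem (show ρ ∈ Iio R from hρR), ENNReal.ofReal_mul hR.le]
      refine mul_le_mul' (ENNReal.ofReal_le_ofReal hρR.le) ?_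
      have hcongr : ∀ θ, (ball c R).indicator (fun z => ENNReal.ofReal (-Real.log ‖g z‖))
          (circleMap c ρ θ) = ENNReal.ofReal (-Real.log ‖g (circleMap c ρ θ)‖) :=
        fun θ => indicator_of_mem (hmem θ) _
      simp only [hcongr]
      rw [← ofReal_integral_eq_lintegral_ofReal hneg (Filter.Eventually.of_forall fun θ =>
        neg_nonneg.2 (Real.log_nonpos (norm_nonneg _) (hle _ (hmem θ))))]
      refine ENNReal.ofReal_le_ofReal ?_
      have h1 := log_norm_le_circleAverage hg hc hρ
      rw [circleAverage_eq_setIntegral, inv_mul_eq_div, le_div_iff₀ Real.two_pi_pos] at h1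
      rw [integral_neg]
      linarith
    · have hcongr : ∀ θ, (ball c R).indicator (fun z => ENNReal.ofReal (-Real.log ‖g z‖))
          (circleMap c ρ θ) = 0 := fun θ => indicator_of_notMem (by
            rw [mem_ball, hdist]; exact hρR) _
      simp [hcongr]
  refine (setLIntegral_mono' measurableSet_Ioi key).trans ?_
  rw [lintegral_indicator measurableSet_Iio, lintegral_const, Measure.restrict_apply_univ,
    Measure.restrict_apply measurableSet_Iio, Iio_inter_Ioi, Real.volume_Ioo, sub_zero, mul_comm,
    ← ENNReal.ofReal_mul hR.le, ← mul_assoc]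

theorem setLIntegral_biUnion_finset_le {α ι : Type*} [MeasurableSpace α] {μ : Measure α}
    (s : Finset ι) (t : ι → Set α) (F : α → ENNReal) :
    ∫⁻ x in ⋃ i ∈ s, t i, F x ∂μ ≤ ∑ i ∈ s, ∫⁻ x in t i, F x ∂μ := by
  classical
  induction s using Finset.induction_on with
  | empty => simp
  | insert j s hj ih =>
    rw [Finset.set_biUnion_insert, Finset.sum_insert hj]
    exact (lintegral_union_le _ _ _).trans (add_le_add le_rfl ih)

/-- The part of a strip through the origin in an annulus of width one is contained in two disks
of bounded radius. -/
theorem norm_sub_le_of_mem_strip {d z : ℂ} (hd : d ≠ 0) {K r : ℝ} (hK : 0 ≤ K)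
    (hz : |inner ℝ z d| ≤ K) (h1 : r ≤ ‖z‖) (h2 : ‖z‖ ≤ r + 1) :
    ∃ ε ∈ ({1, -1} : Finset ℝ),
      ‖z - ((ε * r / ‖d‖ : ℝ) : ℂ) * (Complex.I * d)‖ ≤ 2 * (K / ‖d‖) + 1 := by
  have hd0 : 0 < ‖d‖ := norm_pos_iff.2 hd
  have hdc : (‖d‖ : ℂ) ≠ 0 := by exact_mod_cast hd0.ne'
  -- The rotation taking d to the positive real axis makes the strip vertical: Re w = ⟨z, d⟩/‖d‖.
  -- With |w| in [r, r+1], this forces Im w to be near r or -r.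
  set w : ℂ := z * (starRingEnd ℂ) d / ‖d‖ with hw
  have hdd : (starRingEnd ℂ) d * d = (‖d‖ : ℂ) * ‖d‖ := by
    rw [mul_comm, Complex.mul_conj, Complex.normSq_eq_norm_sq]; push_cast; ring
  have hwn : ‖w‖ = ‖z‖ := by
    rw [hw, norm_div, norm_mul, RCLike.norm_conj, Complex.norm_real, norm_norm]
    field_simp
  have hwre : |w.re| ≤ K / ‖d‖ := by
    have : w.re = inner ℝ z d / ‖d‖ := by
      rw [hw, Complex.div_ofReal_re, ← real_inner_comm, Complex.inner]
    rw [this, abs_div, abs_norm]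
    gcongr
  have hshift : ∀ s : ℝ, ‖z - ((s / ‖d‖ : ℝ) : ℂ) * (Complex.I * d)‖ = ‖w - s * Complex.I‖ := by
    intro s
    have : w - s * Complex.I =
        (z - ((s / ‖d‖ : ℝ) : ℂ) * (Complex.I * d)) * ((starRingEnd ℂ) d / ‖d‖) := by
      rw [hw, sub_mul]
      congr 1
      · ring
      · push_cast
        field_simp
        rw [mul_assoc, mul_comm d, hdd]
        ring
    rw [this, norm_mul, norm_div, RCLike.norm_conj, Complex.norm_real, norm_norm, div_self hd0.ne',
      mul_one]
  have him : |w.im| ≤ r + 1 := (Complex.abs_im_le_norm w).trans (hwn.trans_le h2)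
  have him' : r - K / ‖d‖ ≤ |w.im| := by
    have := Complex.norm_le_abs_re_add_abs_im w
    linarith
  have hq : 0 ≤ K / ‖d‖ := by positivity
  have hfin : ∀ s : ℝ, |w.im - s| ≤ K / ‖d‖ + 1 → ‖w - s * Complex.I‖ ≤ 2 * (K / ‖d‖) + 1 := by
    intro s hs
    refine (Complex.norm_le_abs_re_add_abs_im _).trans ?_
    simp
    linarith
  rcases le_total 0 w.im with h | h
  · refine ⟨1, by simp, ?_⟩
    rw [hshift]
    apply hfin
    rw [abs_of_nonneg h] at him him'
    rw [abs_le]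
    constructor <;> linarith
  · refine ⟨-1, by simp, ?_⟩
    rw [hshift]
    apply hfin
    rw [abs_of_nonpos h] at him him'
    rw [abs_le]
    constructor <;> linarith

variable {Λ : Finset ℂ} {c : ℂ → ℂ}

theorem pairSum_le_card (Λ : Finset ℂ) (z : ℂ) : pairSum Λ z ≤ Λ.offDiag.card := by
  have : pairSum Λ z ≤ Λ.offDiag.card • (1 : ℝ) :=
    Finset.sum_le_card_nsmul _ _ _ fun p _ => Real.exp_le_one_iff.2 (by simp)
  simpa using this

theorem measurable_deficit (Λ : Finset ℂ) (c : ℂ → ℂ) :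
    Measurable fun z => ENNReal.ofReal (-Real.log (‖expSum Λ c z‖ / absSum Λ c z)) := by
  have h1 := (differentiable_expSum Λ c).continuous.measurable
  have h2 := (continuous_absSum Λ c).measurable
  fun_prop

/-- Within bounded distance of p there is a point w outside the strips, where |f| is comparable to
S. Divided by the upper bound A of S on a disk about w, f is bounded by one there and bounded below
at w by a constant independent of p, so the area estimate centred at w applies. -/
theorem exists_setLIntegral_deficit_le (hΛ : Λ.Nonempty) (hc : ∀ a ∈ Λ, c a ≠ 0) {R : ℝ}
    (hR : 0 < R) :
    ∃ C : ℝ, ∀ p : ℂ, ∫⁻ z in ball p R,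
      ENNReal.ofReal (-Real.log (‖expSum Λ c z‖ / absSum Λ c z)) ≤ ENNReal.ofReal C := by
  obtain ⟨K, C, hK, hC, hKC⟩ := exists_log_absSum_sub_le hΛ hc
  obtain ⟨R₁, hR₁, hgood⟩ := exists_dist_le_forall_le_abs_inner Λ.offDiag (fun p => p.1 - p.2)
    (fun p hp => sub_ne_zero.2 (Finset.mem_offDiag.1 hp).2.2) K hK.le
  set L := ∑ a ∈ Λ, ‖a‖ with hL
  have hL0 : 0 ≤ L := Finset.sum_nonneg fun _ _ => norm_nonneg _
  set R₂ := R + R₁ with hR₂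
  have hR₂0 : 0 < R₂ := by positivity
  refine ⟨R₂ * R₂ * (2 * Real.pi * (C * Λ.offDiag.card + L * R₂)), fun p => ?_⟩
  obtain ⟨w, hwp, hw⟩ := hgood p
  obtain ⟨hfw, hlog⟩ := hKC w hw
  set A := absSum Λ c w * Real.exp (L * R₂) with hA
  have hSw := absSum_pos hΛ hc w
  have hA0 : 0 < A := by positivity
  set g : ℂ → ℂ := fun z => expSum Λ c z / A with hg
  have hgd : Differentiable ℂ g := (differentiable_expSum Λ c).div_const _
  have hgn : ∀ z, ‖g z‖ = ‖expSum Λ c z‖ / A := fun z => by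
    rw [hg, norm_div, Complex.norm_real, Real.norm_of_nonneg hA0.le]
  have hSA : ∀ z ∈ ball w R₂, absSum Λ c z ≤ A := fun z hz => by
    refine (absSum_le_mul_exp Λ c w z).trans ?_
    rw [hA]
    gcongr
    exact (mem_ball_iff_norm.1 hz).le
  have hsub : ball p R ⊆ ball w R₂ := ball_subset_ball' (by
    rw [dist_comm, dist_eq_norm, hR₂]; linarith)
  calc _ ≤ ∫⁻ z in ball w R₂, ENNReal.ofReal (-Real.log (‖expSum Λ c z‖ / absSum Λ c z)) :=
        lintegral_mono_set hsub
    _ ≤ ∫⁻ z in ball w R₂, ENNReal.ofReal (-Real.log ‖g z‖) := by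
        refine setLIntegral_mono' measurableSet_ball fun z hz => ENNReal.ofReal_le_ofReal ?_
        rw [hgn]
        -- At a zero of f the convention log 0 = 0 makes both sides vanish.
        rcases (norm_nonneg (expSum Λ c z)).eq_or_lt with h0 | h0
        · rw [← h0]; simp
        · have hSz := absSum_pos hΛ hc z
          refine neg_le_neg (Real.log_le_log (by positivity) ?_)
          gcongr
          exact hSA z hz
    _ ≤ ENNReal.ofReal (R₂ * R₂ * (2 * Real.pi * (-Real.log ‖g w‖))) := by
        refine setLIntegral_neg_log_norm_le hgd hR₂0 (fun z hz => ?_) ?_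
        · rw [hgn, div_le_one hA0]
          exact (norm_expSum_le Λ c z).trans (hSA z hz)
        · simp [hg, hfw, hA0.ne']
    _ ≤ _ := by
        refine ENNReal.ofReal_le_ofReal ?_
        have : -Real.log ‖g w‖ ≤ C * Λ.offDiag.card + L * R₂ := by
          rw [hgn, Real.log_div (norm_ne_zero_iff.2 hfw) hA0.ne', hA,
            Real.log_mul hSw.ne' (Real.exp_pos _).ne', Real.log_exp]
          have := mul_le_mul_of_nonneg_left (pairSum_le_card Λ w) hC
          linarith
        have := Real.pi_pos
        gcongr

/-- The union of the strips in which two terms of an exponential sum have similar sizes. -/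
def strips (Λ : Finset ℂ) (K : ℝ) : Set ℂ :=
  {z | ∃ p ∈ Λ.offDiag, |inner ℝ z (p.1 - p.2)| < K}

theorem measurableSet_strips (Λ : Finset ℂ) (K : ℝ) : MeasurableSet (strips Λ K) := by
  have : strips Λ K = ⋃ p ∈ Λ.offDiag, {z | |inner ℝ z (p.1 - p.2)| < K} := by
    ext z
    simp [strips]
  rw [this]
  refine Finset.measurableSet_biUnion _ fun p _ => (isOpen_lt ?_ ?_).measurableSet <;> fun_prop

/-- The annulus meets each strip inside two disks, so the number and the radius of the covering
disks do not depend on r. -/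
theorem exists_setLIntegral_strips_le (hΛ : Λ.Nonempty) (hc : ∀ a ∈ Λ, c a ≠ 0) {K : ℝ}
    (hK : 0 ≤ K) :
    ∃ C : ℝ, 0 ≤ C ∧ ∀ r : ℝ, 0 ≤ r →
      ∫⁻ z in strips Λ K ∩ {z | r ≤ ‖z‖ ∧ ‖z‖ ≤ r + 1},
        ENNReal.ofReal (-Real.log (‖expSum Λ c z‖ / absSum Λ c z)) ≤ ENNReal.ofReal C := by
  -- The sum dominates the radius needed for each single strip; 2 instead of 1 makes the inequality
  -- strict, as open balls require.
  set R : ℝ := ∑ p ∈ Λ.offDiag, 2 * (K / ‖p.1 - p.2‖) + 2 with hR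
  have hsum0 : 0 ≤ ∑ p ∈ Λ.offDiag, 2 * (K / ‖p.1 - p.2‖) :=
    Finset.sum_nonneg fun _ _ => by positivity
  obtain ⟨C, hC⟩ := exists_setLIntegral_deficit_le hΛ hc (show 0 < R by positivity)
  set I := Λ.offDiag ×ˢ ({1, -1} : Finset ℝ) with hI
  refine ⟨I.card * max C 0, by positivity, fun r hr => ?_⟩
  set q : (ℂ × ℂ) × ℝ → ℂ := fun i =>
    ((i.2 * r / ‖i.1.1 - i.1.2‖ : ℝ) : ℂ) * (Complex.I * (i.1.1 - i.1.2)) with hq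
  have hcover : strips Λ K ∩ {z | r ≤ ‖z‖ ∧ ‖z‖ ≤ r + 1} ⊆ ⋃ i ∈ I, ball (q i) R := by
    rintro z ⟨⟨p, hp, hzp⟩, h1, h2⟩
    obtain ⟨ε, hε, hle⟩ := norm_sub_le_of_mem_strip
      (sub_ne_zero.2 (Finset.mem_offDiag.1 hp).2.2) hK hzp.le h1 h2
    simp only [mem_iUnion]
    refine ⟨(p, ε), Finset.mem_product.2 ⟨hp, hε⟩, ?_⟩
    rw [mem_ball_iff_norm, hq]
    have := Finset.single_le_sum (f := fun p : ℂ × ℂ => 2 * (K / ‖p.1 - p.2‖))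
      (fun _ _ => by positivity) hp
    simp only at this ⊢
    linarith
  calc _ ≤ _ := lintegral_mono_set hcover
    _ ≤ _ := setLIntegral_biUnion_finset_le I _ _
    _ ≤ ∑ i ∈ I, ENNReal.ofReal (max C 0) := Finset.sum_le_sum fun i _ =>
        (hC (q i)).trans (ENNReal.ofReal_le_ofReal (le_max_left _ _))
    _ = _ := by
        rw [Finset.sum_const, nsmul_eq_mul, ENNReal.ofReal_mul (by positivity),
          ENNReal.ofReal_natCast]

/-- In every annulus of width one there is a circle on which the integral of the logarithm of the
exponential sum over the strips is bounded below. -/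
theorem exists_radius (hΛ : Λ.Nonempty) (hc : ∀ a ∈ Λ, c a ≠ 0) {K : ℝ} (hK : 0 ≤ K) :
    ∃ C : ℝ, 0 ≤ C ∧ ∀ r : ℝ, 0 < r → ∃ t ∈ Icc r (r + 1),
      ∫⁻ θ in Ioc (-Real.pi) Real.pi, (strips Λ K).indicator
        (fun z => ENNReal.ofReal (-Real.log (‖expSum Λ c z‖ / absSum Λ c z))) (circleMap 0 t θ) ≤
      ENNReal.ofReal (C / t) := by
  obtain ⟨C, hC0, hC⟩ := exists_setLIntegral_strips_le hΛ hc hK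
  refine ⟨C + 1, by positivity, fun r hr => ?_⟩
  by_contra! hcon
  have hr1 := hC r hr.le
  set D := fun z => ENNReal.ofReal (-Real.log (‖expSum Λ c z‖ / absSum Λ c z)) with hD
  have hDm : Measurable D := measurable_deficit Λ c
  set N : Set ℂ := {z | r ≤ ‖z‖ ∧ ‖z‖ ≤ r + 1} with hN
  have hNm : MeasurableSet N :=
    ((isClosed_le continuous_const continuous_norm).inter
      (isClosed_le continuous_norm continuous_const)).measurableSet
  have hsm := (measurableSet_strips Λ K).inter hNm
  rw [← lintegral_indicator hsm, lintegral_eq_lintegral_circleMap (hDm.indicator hsm) 0] at hr1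
  -- If the bound failed on every circle of the annulus, integration in polar coordinates, where ρ
  -- cancels 1/ρ, would make the area integral at least C + 1.
  have hlow : ENNReal.ofReal (C + 1) ≤ ENNReal.ofReal C := by
    refine le_trans ?_ hr1
    calc ENNReal.ofReal (C + 1) = ∫⁻ _ in Icc r (r + 1), ENNReal.ofReal (C + 1) := by
          simp
      _ ≤ ∫⁻ ρ in Icc r (r + 1), ENNReal.ofReal ρ * ∫⁻ θ in Ioc (-Real.pi) Real.pi,
            (strips Λ K ∩ N).indicator D (circleMap 0 ρ θ) := by
          refine setLIntegral_mono' measurableSet_Icc fun ρ hρ => ?_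
          have hρ0 : 0 < ρ := hr.trans_le hρ.1
          have hmem : ∀ θ, circleMap 0 ρ θ ∈ N := fun θ => by
            rw [hN, mem_ofPred_eq, norm_circleMap_zero, abs_of_pos hρ0]
            exact hρ
          have hcongr : ∀ θ, (strips Λ K ∩ N).indicator D (circleMap 0 ρ θ) =
              (strips Λ K).indicator D (circleMap 0 ρ θ) := fun θ => by
            rw [inter_comm, ← indicator_indicator, indicator_of_mem (hmem θ)]
          simp only [hcongr]
          calc ENNReal.ofReal (C + 1) = ENNReal.ofReal ρ * ENNReal.ofReal ((C + 1) / ρ) := by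
                rw [← ENNReal.ofReal_mul hρ0.le, mul_div_cancel₀ _ hρ0.ne']
            _ ≤ _ := mul_le_mul' le_rfl (hcon ρ hρ).le
      _ ≤ _ := lintegral_mono_set fun ρ hρ => hr.trans_le hρ.1
  rw [ENNReal.ofReal_le_ofReal_iff hC0] at hlow
  linarith

/-! ### Comparison of the circle averages of log|f| and log S -/

theorem exists_expSum_ne_zero (hΛ : Λ.Nonempty) (hc : ∀ a ∈ Λ, c a ≠ 0) :
    ∃ w, expSum Λ c w ≠ 0 := by
  obtain ⟨K, C, hK, hC, hKC⟩ := exists_log_absSum_sub_le hΛ hc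
  obtain ⟨R₁, hR₁, hgood⟩ := exists_dist_le_forall_le_abs_inner Λ.offDiag (fun p => p.1 - p.2)
    (fun p hp => sub_ne_zero.2 (Finset.mem_offDiag.1 hp).2.2) K hK.le
  obtain ⟨w, -, hw⟩ := hgood 0
  exact ⟨w, (hKC w hw).1⟩

/-- Since log 0 = 0 by convention, log|f| ≤ log S can fail at zeros of f; the comparison of averages
therefore holds only almost everywhere under the integral. -/
theorem ae_circleMap_ne_zero {f : ℂ → ℂ} (hf : Differentiable ℂ f) {w : ℂ} (hw : f w ≠ 0) {t : ℝ}
    (ht : 0 < t) : ∀ᵐ θ, f (circleMap 0 t θ) ≠ 0 := by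
  have h := ((finite_zeros hf hw t).countable.preimage_circleMap 0 ht.ne').measure_zero volume
  refine measure_mono_null (fun θ hθ => ?_) h
  simp only [ne_eq, mem_compl_iff, mem_ofPred_eq, not_not] at hθ
  simp [hθ, abs_of_pos ht]

theorem circleIntegrable_log_absSum (hΛ : Λ.Nonempty) (hc : ∀ a ∈ Λ, c a ≠ 0) (t : ℝ) :
    CircleIntegrable (fun z => Real.log (absSum Λ c z)) 0 t :=
  (Continuous.continuousOn ((continuous_absSum Λ c).log fun z =>
    (absSum_pos hΛ hc z).ne')).circleIntegrable'

theorem circleIntegrable_log_expSum (Λ : Finset ℂ) (c : ℂ → ℂ) (t : ℝ) :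
    CircleIntegrable (fun z => Real.log ‖expSum Λ c z‖) 0 t :=
  MeromorphicOn.circleIntegrable_log_norm fun z _ =>
    ((differentiable_expSum Λ c).analyticAt z).meromorphicAt

theorem circleAverage_log_norm_expSum_le (hΛ : Λ.Nonempty) (hc : ∀ a ∈ Λ, c a ≠ 0) {t : ℝ}
    (ht : 0 < t) :
    Real.circleAverage (fun z => Real.log ‖expSum Λ c z‖) 0 t ≤
      Real.circleAverage (fun z => Real.log (absSum Λ c z)) 0 t := by
  obtain ⟨w, hw⟩ := exists_expSum_ne_zero hΛ hc
  rw [circleAverage_eq_setIntegral, circleAverage_eq_setIntegral]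
  refine mul_le_mul_of_nonneg_left ?_ (inv_nonneg.2 Real.two_pi_pos.le)
  refine integral_mono_ae (integrableOn_of_circleIntegrable (circleIntegrable_log_expSum Λ c t))
    (integrableOn_of_circleIntegrable (circleIntegrable_log_absSum hΛ hc t)) ?_
  filter_upwards [ae_restrict_of_ae (ae_circleMap_ne_zero (differentiable_expSum Λ c) hw ht)]
    with θ hθ
  exact Real.log_le_log (norm_pos_iff.2 hθ) (norm_expSum_le Λ c _)

theorem exists_radius_circleAverage_ge (hΛ : Λ.Nonempty) (hc : ∀ a ∈ Λ, c a ≠ 0) :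
    ∃ C : ℝ, 0 ≤ C ∧ ∀ r : ℝ, 0 < r → ∃ t ∈ Icc r (r + 1),
      Real.circleAverage (fun z => Real.log (absSum Λ c z)) 0 t - C / t ≤
        Real.circleAverage (fun z => Real.log ‖expSum Λ c z‖) 0 t := by
  obtain ⟨w, hw⟩ := exists_expSum_ne_zero hΛ hc
  obtain ⟨K, C₁, hK, hC₁, hKC⟩ := exists_log_absSum_sub_le hΛ hc
  obtain ⟨C₂, hC₂, hrad⟩ := exists_radius hΛ hc hK.le
  obtain ⟨C₃, hC₃, hpair⟩ := exists_circleAverage_pairSum_le Λ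
  refine ⟨C₁ * C₃ + (2 * Real.pi)⁻¹ * C₂, by positivity, fun r hr => ?_⟩
  obtain ⟨t, htr, ht⟩ := hrad r hr
  have ht0 : 0 < t := hr.trans_le htr.1
  refine ⟨t, htr, ?_⟩
  have hi1 := integrableOn_of_circleIntegrable (circleIntegrable_log_absSum hΛ hc t)
  have hi2 := integrableOn_of_circleIntegrable (circleIntegrable_log_expSum Λ c t)
  have hi3 := (integrableOn_of_circleIntegrable (c := 0) (t := t)
    (continuous_pairSum Λ).continuousOn.circleIntegrable').const_mul C₁
  set G : ℝ → ℝ := fun θ => Real.log (absSum Λ c (circleMap 0 t θ)) -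
    Real.log ‖expSum Λ c (circleMap 0 t θ)‖ - C₁ * pairSum Λ (circleMap 0 t θ) with hG
  have hGi : IntegrableOn G (Ioc (-Real.pi) Real.pi) := (hi1.sub hi2).sub hi3
  have hGle : ∫ θ in Ioc (-Real.pi) Real.pi, G θ ≤ C₂ / t := by
    -- Only the positive part of G matters: off the strips G ≤ 0, and on them G is at most the
    -- deficit, whose integral over this circle is small by the choice of t.
    rw [integral_eq_lintegral_pos_part_sub_lintegral_neg_part hGi]
    refine (sub_le_self _ ENNReal.toReal_nonneg).trans ?_
    refine ENNReal.toReal_le_of_le_ofReal (by positivity) (le_trans ?_ ht)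
    refine lintegral_mono_ae ?_
    filter_upwards [ae_restrict_of_ae (ae_circleMap_ne_zero (differentiable_expSum Λ c) hw ht0)]
      with θ hθ
    by_cases hs : circleMap 0 t θ ∈ strips Λ K
    · rw [indicator_of_mem hs, Real.log_div (norm_ne_zero_iff.2 hθ) (absSum_pos hΛ hc _).ne']
      refine ENNReal.ofReal_le_ofReal ?_
      have := mul_nonneg hC₁ (pairSum_nonneg Λ (circleMap 0 t θ))
      rw [hG]
      simp only
      linarith
    · have h1 := (hKC (circleMap 0 t θ) fun p hp => not_lt.1 fun h => hs ⟨p, hp, h⟩).2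
      rw [ENNReal.ofReal_of_nonpos]
      · exact zero_le
      · rw [hG]
        simp only
        linarith
  have hsplit : ∫ θ in Ioc (-Real.pi) Real.pi, G θ =
      2 * Real.pi * (Real.circleAverage (fun z => Real.log (absSum Λ c z)) 0 t -
        Real.circleAverage (fun z => Real.log ‖expSum Λ c z‖) 0 t -
          C₁ * Real.circleAverage (pairSum Λ) 0 t) := by
    rw [circleAverage_eq_setIntegral, circleAverage_eq_setIntegral, circleAverage_eq_setIntegral,
      hG]
    have e1 := integral_sub (hi1.sub hi2) hi3
    have e2 := integral_sub hi1 hi2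
    simp only [Pi.sub_apply] at e1
    rw [e1, e2, integral_const_mul]
    field_simp
  have h1 : Real.circleAverage (fun z => Real.log (absSum Λ c z)) 0 t -
        Real.circleAverage (fun z => Real.log ‖expSum Λ c z‖) 0 t -
          C₁ * Real.circleAverage (pairSum Λ) 0 t ≤ (2 * Real.pi)⁻¹ * (C₂ / t) := by
    rw [hsplit] at hGle
    rw [inv_mul_eq_div, le_div_iff₀ Real.two_pi_pos]
    linarith
  have h2 := mul_le_mul_of_nonneg_left (hpair t ht0) hC₁
  have h3 : (C₁ * C₃ + (2 * Real.pi)⁻¹ * C₂) / t =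
      C₁ * (C₃ / t) + (2 * Real.pi)⁻¹ * (C₂ / t) := by ring
  linarith

end ExponentialSum

/-! ### Cauchy's formula for the perimeter -/

namespace ExponentialSum

open Set Filter Topology

theorem inner_sq_add_inner_mul_I_sq (u d : ℂ) :
    (inner ℝ u d : ℝ) ^ 2 + (inner ℝ (u * Complex.I) d : ℝ) ^ 2 = ‖u‖ ^ 2 * ‖d‖ ^ 2 := by
  rw [← Complex.normSq_eq_norm_sq, ← Complex.normSq_eq_norm_sq, Complex.inner, Complex.inner]
  simp [Complex.normSq_apply]
  ring

theorem eq_zero_of_inner_eq_zero {u d : ℂ} (hu : ‖u‖ = 1) (h1 : inner ℝ u d = (0 : ℝ))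
    (h2 : inner ℝ (u * Complex.I) d = (0 : ℝ)) : d = 0 := by
  have h := inner_sq_add_inner_mul_I_sq u d
  rw [h1, h2, hu] at h
  simpa using h.symm

theorem norm_circleMap_one (θ : ℝ) : ‖circleMap 0 1 θ‖ = 1 := by
  rw [norm_circleMap_zero, abs_one]

theorem hasDerivAt_inner_circleMap (a : ℂ) (θ : ℝ) :
    HasDerivAt (fun θ => (inner ℝ (circleMap 0 1 θ) a : ℝ))
      (inner ℝ (circleMap 0 1 θ * Complex.I) a) θ := by
  simpa using (hasDerivAt_circleMap 0 1 θ).inner ℝ (hasDerivAt_const θ a)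

theorem hasDerivAt_inner_circleMap_mul_I (a : ℂ) (θ : ℝ) :
    HasDerivAt (fun θ => (inner ℝ (circleMap 0 1 θ * Complex.I) a : ℝ))
      (-inner ℝ (circleMap 0 1 θ) a) θ := by
  have h := ((hasDerivAt_circleMap 0 1 θ).mul_const Complex.I).inner ℝ (hasDerivAt_const θ a)
  have h2 : circleMap 0 1 θ * Complex.I * Complex.I = -circleMap 0 1 θ := by
    rw [mul_assoc, Complex.I_mul_I, mul_neg_one]
  rw [h2] at h
  simpa [inner_neg_left] using h

theorem integral_inner_circleMap (a : ℂ) (x y : ℝ) :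
    ∫ θ in x..y, (inner ℝ (circleMap 0 1 θ) a : ℝ) =
      inner ℝ (circleMap 0 1 x * Complex.I) a - inner ℝ (circleMap 0 1 y * Complex.I) a := by
  have h := intervalIntegral.integral_eq_sub_of_hasDerivAt (a := x) (b := y)
    (fun θ _ => (hasDerivAt_inner_circleMap_mul_I a θ).neg)
    (Continuous.intervalIntegrable (by fun_prop) _ _)
  simp only [neg_neg, Pi.neg_apply] at h
  rw [h]
  ring

theorem eventually_pos_nhdsGT {g : ℝ → ℝ} {g' x : ℝ} (hg : HasDerivAt g g' x) (h0 : 0 ≤ g x)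
    (h : g x = 0 → 0 < g') : ∀ᶠ y in 𝓝[>] x, 0 < g y := by
  rcases h0.eq_or_lt with h0 | h0
  · have ht := (hasDerivAt_iff_tendsto_slope.1 hg).mono_left
      (nhdsWithin_mono x fun y (hy : x < y) => hy.ne')
    filter_upwards [ht.eventually (lt_mem_nhds (h h0.symm)), self_mem_nhdsWithin] with y hy hxy
    rw [slope_def_field, ← h0, sub_zero] at hy
    exact (div_pos_iff_of_pos_right (sub_pos.2 hxy)).1 hy
  · exact (hg.continuousAt.eventually (lt_mem_nhds h0)).filter_mono nhdsWithin_le_nhds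

theorem eventually_pos_nhdsLT {g : ℝ → ℝ} {g' x : ℝ} (hg : HasDerivAt g g' x) (h0 : 0 ≤ g x)
    (h : g x = 0 → g' < 0) : ∀ᶠ y in 𝓝[<] x, 0 < g y := by
  rcases h0.eq_or_lt with h0 | h0
  · have ht := (hasDerivAt_iff_tendsto_slope.1 hg).mono_left
      (nhdsWithin_mono x fun y (hy : y < x) => hy.ne)
    filter_upwards [ht.eventually (gt_mem_nhds (h h0.symm)), self_mem_nhdsWithin] with y hy hxy
    rw [slope_def_field, ← h0, sub_zero, div_lt_iff_of_neg (sub_neg.2 hxy), zero_mul] at hy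
    exact hy
  · exact (hg.continuousAt.eventually (lt_mem_nhds h0)).filter_mono nhdsWithin_le_nhds

open Classical in
/-- The points of the spectrum which are extremal in a given direction. -/
noncomputable def maxSet (Λ : Finset ℂ) (u : ℂ) : Finset ℂ :=
  Λ.filter fun a => ∀ b ∈ Λ, (inner ℝ u b : ℝ) ≤ inner ℝ u a

variable {Λ : Finset ℂ}

theorem mem_maxSet {u a : ℂ} :
    a ∈ maxSet Λ u ↔ a ∈ Λ ∧ ∀ b ∈ Λ, (inner ℝ u b : ℝ) ≤ inner ℝ u a := by
  simp [maxSet]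

theorem maxSet_nonempty (hΛ : Λ.Nonempty) (u : ℂ) : (maxSet Λ u).Nonempty := by
  obtain ⟨a, ha, hm⟩ := Λ.exists_max_image (fun a => (inner ℝ u a : ℝ)) hΛ
  exact ⟨a, mem_maxSet.2 ⟨ha, hm⟩⟩

/-- The largest tangential coordinate of an extremal point. -/
noncomputable def tangentMax (Λ : Finset ℂ) (hΛ : Λ.Nonempty) (u : ℂ) : ℝ :=
  (maxSet Λ u).sup' (maxSet_nonempty hΛ u) fun a => inner ℝ (u * Complex.I) a

/-- The smallest tangential coordinate of an extremal point. -/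
noncomputable def tangentMin (Λ : Finset ℂ) (hΛ : Λ.Nonempty) (u : ℂ) : ℝ :=
  (maxSet Λ u).inf' (maxSet_nonempty hΛ u) fun a => inner ℝ (u * Complex.I) a

theorem supportFun_eq (hΛ : Λ.Nonempty) {u a : ℂ} (ha : a ∈ maxSet Λ u) :
    supportFun Λ hΛ u = inner ℝ u a := by
  rw [mem_maxSet] at ha
  exact le_antisymm (Finset.sup'_le hΛ _ ha.2)
    (Finset.le_sup' (fun a => (inner ℝ u a : ℝ)) ha.1)

theorem maxSet_eq_singleton {u a : ℂ} (ha : a ∈ Λ)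
    (h : ∀ b ∈ Λ, b ≠ a → (inner ℝ u b : ℝ) < inner ℝ u a) : maxSet Λ u = {a} := by
  ext b
  rw [mem_maxSet, Finset.mem_singleton]
  constructor
  · rintro ⟨hb, hm⟩
    by_contra hne
    exact (h b hb hne).not_ge (hm a ha)
  · rintro rfl
    exact ⟨ha, fun b' hb' => by
      rcases eq_or_ne b' b with rfl | hne
      · exact le_rfl
      · exact (h b' hb' hne).le⟩

theorem tangentMax_eq (hΛ : Λ.Nonempty) {u a : ℂ} (h : maxSet Λ u = {a}) :
    tangentMax Λ hΛ u = inner ℝ (u * Complex.I) a := by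
  simp [tangentMax, h]

/-- The derivative of θ ↦ ⟨u, a⟩ is the tangential coordinate ⟨u * I, a⟩. Among the maximisers at x
the one with the largest derivative wins just after x; a tie in value and derivative would make two
points equal. -/
theorem exists_dominant_right (hΛ : Λ.Nonempty) (x : ℝ) :
    ∃ a ∈ maxSet Λ (circleMap 0 1 x),
      tangentMax Λ hΛ (circleMap 0 1 x) = inner ℝ (circleMap 0 1 x * Complex.I) a ∧
      ∀ᶠ y in 𝓝[>] x, maxSet Λ (circleMap 0 1 y) = {a} := by
  obtain ⟨a, ha, hta⟩ := Finset.exists_mem_eq_sup' (maxSet_nonempty hΛ (circleMap 0 1 x))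
    fun a => (inner ℝ (circleMap 0 1 x * Complex.I) a : ℝ)
  refine ⟨a, ha, hta, ?_⟩
  obtain ⟨haΛ, hmax⟩ := mem_maxSet.1 ha
  have : ∀ b ∈ Λ, ∀ᶠ y in 𝓝[>] x, b ≠ a →
      (inner ℝ (circleMap 0 1 y) b : ℝ) < inner ℝ (circleMap 0 1 y) a := by
    intro b hb
    by_cases hba : b = a
    · exact Eventually.of_forall fun y h => absurd hba h
    · have hd := hasDerivAt_inner_circleMap (a - b) x
      have := eventually_pos_nhdsGT hd
        (by rw [inner_sub_right]; linarith [hmax b hb]) fun h0 => by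
        have hb' : b ∈ maxSet Λ (circleMap 0 1 x) := mem_maxSet.2 ⟨hb, fun b' hb' => by
          rw [inner_sub_right] at h0
          linarith [hmax b' hb']⟩
        have hle := Finset.le_sup' (fun a => (inner ℝ (circleMap 0 1 x * Complex.I) a : ℝ)) hb'
        rw [hta] at hle
        refine lt_of_le_of_ne (by rw [inner_sub_right]; linarith) fun h1 => hba ?_
        exact (sub_eq_zero.1 (eq_zero_of_inner_eq_zero (norm_circleMap_one x) h0 h1.symm)).symm
      filter_upwards [this] with y hy _
      rw [inner_sub_right] at hy
      linarith
  filter_upwards [(eventually_all_finset Λ).2 this] with y hy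
  exact maxSet_eq_singleton haΛ hy

/-- Just before x the winner is the maximiser with the smallest derivative. So h has left derivative
`tangentMin` and right derivative `tangentMax`, and the derivative jumps by the length of the face.
-/
theorem exists_dominant_left (hΛ : Λ.Nonempty) (x : ℝ) :
    ∃ a ∈ maxSet Λ (circleMap 0 1 x),
      tangentMin Λ hΛ (circleMap 0 1 x) = inner ℝ (circleMap 0 1 x * Complex.I) a ∧
      ∀ᶠ y in 𝓝[<] x, maxSet Λ (circleMap 0 1 y) = {a} := by
  obtain ⟨a, ha, hta⟩ := Finset.exists_mem_eq_inf' (maxSet_nonempty hΛ (circleMap 0 1 x))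
    fun a => (inner ℝ (circleMap 0 1 x * Complex.I) a : ℝ)
  refine ⟨a, ha, hta, ?_⟩
  obtain ⟨haΛ, hmax⟩ := mem_maxSet.1 ha
  have : ∀ b ∈ Λ, ∀ᶠ y in 𝓝[<] x, b ≠ a →
      (inner ℝ (circleMap 0 1 y) b : ℝ) < inner ℝ (circleMap 0 1 y) a := by
    intro b hb
    by_cases hba : b = a
    · exact Eventually.of_forall fun y h => absurd hba h
    · have hd := hasDerivAt_inner_circleMap (a - b) x
      have := eventually_pos_nhdsLT hd
        (by rw [inner_sub_right]; linarith [hmax b hb]) fun h0 => by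
        have hb' : b ∈ maxSet Λ (circleMap 0 1 x) := mem_maxSet.2 ⟨hb, fun b' hb' => by
          rw [inner_sub_right] at h0
          linarith [hmax b' hb']⟩
        have hle := Finset.inf'_le (fun a => (inner ℝ (circleMap 0 1 x * Complex.I) a : ℝ)) hb'
        rw [hta] at hle
        refine lt_of_le_of_ne (by rw [inner_sub_right]; linarith) fun h1 => hba ?_
        exact (sub_eq_zero.1 (eq_zero_of_inner_eq_zero (norm_circleMap_one x) h0 h1)).symm
      filter_upwards [this] with y hy _
      rw [inner_sub_right] at hy
      linarith
  filter_upwards [(eventually_all_finset Λ).2 this] with y hy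
  exact maxSet_eq_singleton haΛ hy

/-- The length of a face is the difference of the extremal tangential coordinates. -/
theorem diam_face (hΛ : Λ.Nonempty) {u : ℂ} (hu : ‖u‖ = 1) :
    Metric.diam (face (newtonPolygon Λ) u) = tangentMax Λ hΛ u - tangentMin Λ hΛ u := by
  have hsub : ∀ a ∈ Λ, a ∈ newtonPolygon Λ := fun a ha =>
    subset_convexHull ℝ _ (Finset.mem_coe.2 ha)
  have hmem : ∀ a ∈ maxSet Λ u, a ∈ face (newtonPolygon Λ) u := by
    intro a ha
    obtain ⟨haΛ, hmax⟩ := mem_maxSet.1 ha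
    refine ⟨hsub a haΛ, fun y hy => ?_⟩
    obtain ⟨w, hw0, hw1, hwx⟩ := Finset.mem_convexHull'.1 hy
    rw [← hwx, inner_sum]
    simp only [inner_smul_right]
    calc ∑ b ∈ Λ, w b * inner ℝ u b ≤ ∑ b ∈ Λ, w b * inner ℝ u a :=
          Finset.sum_le_sum fun b hb => mul_le_mul_of_nonneg_left (hmax b hb) (hw0 b hb)
      _ = inner ℝ u a := by rw [← Finset.sum_mul, hw1, one_mul]
  have hbound : ∀ x ∈ face (newtonPolygon Λ) u,
      tangentMin Λ hΛ u ≤ inner ℝ (u * Complex.I) x ∧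
      inner ℝ (u * Complex.I) x ≤ tangentMax Λ hΛ u := by
    rintro x ⟨hx, hm⟩
    obtain ⟨w, hw0, hw1, hwx⟩ := Finset.mem_convexHull'.1 hx
    have hin : ∀ v : ℂ, inner ℝ v x = ∑ a ∈ Λ, w a * inner ℝ v a := fun v => by
      rw [← hwx, inner_sum]
      simp only [inner_smul_right]
    have hz : ∑ a ∈ Λ, w a * (inner ℝ u x - inner ℝ u a) = 0 := by
      simp only [mul_sub, Finset.sum_sub_distrib, ← Finset.sum_mul, hw1, one_mul]
      rw [← hin, sub_self]
    have hz' := (Finset.sum_eq_zero_iff_of_nonneg (fun a ha =>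
      mul_nonneg (hw0 a ha) (sub_nonneg.2 (hm a (hsub a ha))))).1 hz
    -- A convex combination lying on the face gives weight to extremal points only.
    have hw : ∀ a ∈ Λ, w a = 0 ∨ a ∈ maxSet Λ u := by
      intro a ha
      rcases mul_eq_zero.1 (hz' a ha) with h0 | h0
      · exact Or.inl h0
      · refine Or.inr (mem_maxSet.2 ⟨ha, fun b hb => ?_⟩)
        have := hm b (hsub b hb)
        linarith
    rw [hin]
    constructor
    · calc tangentMin Λ hΛ u = ∑ a ∈ Λ, w a * tangentMin Λ hΛ u := by
            rw [← Finset.sum_mul, hw1, one_mul]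
        _ ≤ _ := Finset.sum_le_sum fun a ha => by
            rcases hw a ha with h | h
            · simp [h]
            · exact mul_le_mul_of_nonneg_left (Finset.inf'_le _ h) (hw0 a ha)
    · calc _ ≤ ∑ a ∈ Λ, w a * tangentMax Λ hΛ u := Finset.sum_le_sum fun a ha => by
            rcases hw a ha with h | h
            · simp [h]
            · exact mul_le_mul_of_nonneg_left
                (Finset.le_sup' (fun a => (inner ℝ (u * Complex.I) a : ℝ)) h) (hw0 a ha)
        _ = tangentMax Λ hΛ u := by rw [← Finset.sum_mul, hw1, one_mul]
  -- On a face ⟨u, ·⟩ is constant, so only the tangential coordinate separates its points.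
  have hdist : ∀ x ∈ face (newtonPolygon Λ) u, ∀ y ∈ face (newtonPolygon Λ) u,
      dist x y = |inner ℝ (u * Complex.I) x - inner ℝ (u * Complex.I) y| := by
    intro x hx y hy
    have h0 : inner ℝ u (x - y) = (0 : ℝ) := by
      rw [inner_sub_right]
      linarith [hx.2 y hy.1, hy.2 x hx.1]
    have h := inner_sq_add_inner_mul_I_sq u (x - y)
    rw [h0, hu, zero_pow two_ne_zero, zero_add, one_pow, one_mul] at h
    rw [dist_eq_norm, ← inner_sub_right, ← abs_norm (x - y)]
    exact (sq_eq_sq_iff_abs_eq_abs _ _).1 h.symm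
  obtain ⟨a, ha, hta⟩ := Finset.exists_mem_eq_sup' (maxSet_nonempty hΛ u)
    fun a => (inner ℝ (u * Complex.I) a : ℝ)
  obtain ⟨b, hb, htb⟩ := Finset.exists_mem_eq_inf' (maxSet_nonempty hΛ u)
    fun a => (inner ℝ (u * Complex.I) a : ℝ)
  have hle : tangentMin Λ hΛ u ≤ tangentMax Λ hΛ u :=
    (hbound a (hmem a ha)).1.trans (hbound a (hmem a ha)).2
  have hdle : ∀ x ∈ face (newtonPolygon Λ) u, ∀ y ∈ face (newtonPolygon Λ) u,
      dist x y ≤ tangentMax Λ hΛ u - tangentMin Λ hΛ u := by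
    intro x hx y hy
    rw [hdist x hx y hy, abs_le]
    have h1 := hbound x hx
    have h2 := hbound y hy
    constructor <;> linarith [h1.1, h1.2, h2.1, h2.2]
  apply le_antisymm
  · exact Metric.diam_le_of_forall_dist_le (sub_nonneg.2 hle) hdle
  · have hbdd : Bornology.IsBounded (face (newtonPolygon Λ) u) :=
      Metric.isBounded_iff.2 ⟨_, fun x hx y hy => hdle x hx y hy⟩
    refine le_trans ?_ (Metric.dist_le_diam_of_mem hbdd (hmem a ha) (hmem b hb))
    rw [hdist a (hmem a ha) b (hmem b hb)]
    refine le_trans (le_of_eq ?_) (le_abs_self _)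
    rw [tangentMax, tangentMin, hta, htb]

/-- The integral of the support function up to `x`, corrected by the right derivative of the
support function and by the jumps of this derivative at the points of `B`. -/
noncomputable def supportPotential (Λ : Finset ℂ) (hΛ : Λ.Nonempty) (B : Finset ℝ) (x : ℝ) : ℝ :=
  (∫ θ in (0 : ℝ)..x, supportFun Λ hΛ (circleMap 0 1 θ)) + tangentMax Λ hΛ (circleMap 0 1 x) -
    ∑ θ ∈ B, if θ ≤ x then
      tangentMax Λ hΛ (circleMap 0 1 θ) - tangentMin Λ hΛ (circleMap 0 1 θ) else 0

theorem intervalIntegrable_supportFun (hΛ : Λ.Nonempty) (x y : ℝ) :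
    IntervalIntegrable (fun θ => supportFun Λ hΛ (circleMap 0 1 θ)) MeasureTheory.volume x y :=
  ((continuous_supportFun hΛ).comp (continuous_circleMap 0 1)).intervalIntegrable x y

/-- Just after x one point a gives h = ⟨u, a⟩, whose antiderivative is -⟨u * I, a⟩; the integral
cancels the change of `tangentMax`, and no point of B is passed. -/
theorem supportPotential_right (hΛ : Λ.Nonempty) (B : Finset ℝ) (x : ℝ) :
    ∃ z, x < z ∧ ∀ y ∈ Ico x z, supportPotential Λ hΛ B y = supportPotential Λ hΛ B x := by
  obtain ⟨a, ha, hta, hev⟩ := exists_dominant_right hΛ x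
  have hB : ∀ᶠ y in 𝓝[>] x, ∀ θ ∈ B, (θ ≤ y ↔ θ ≤ x) := by
    refine (eventually_all_finset B).2 fun θ _ => ?_
    rcases le_or_gt θ x with h | h
    · filter_upwards [self_mem_nhdsWithin] with y hy
      exact ⟨fun _ => h, fun _ => h.trans (le_of_lt hy)⟩
    · filter_upwards [nhdsWithin_le_nhds (Iio_mem_nhds h)] with y hy
      exact ⟨fun h' => absurd h' (not_le.2 hy), fun h' => absurd h' (not_le.2 h)⟩
  obtain ⟨z, hz, hsub⟩ := mem_nhdsGT_iff_exists_Ioo_subset.1 (hev.and hB)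
  refine ⟨z, hz, fun y hy => ?_⟩
  rcases hy.1.eq_or_lt with rfl | hxy
  · rfl
  have hint : ∫ θ in x..y, supportFun Λ hΛ (circleMap 0 1 θ) =
      ∫ θ in x..y, (inner ℝ (circleMap 0 1 θ) a : ℝ) := by
    refine intervalIntegral.integral_congr fun θ hθ => ?_
    rw [uIcc_of_le hxy.le] at hθ
    refine supportFun_eq hΛ ?_
    rcases hθ.1.eq_or_lt with rfl | h
    · exact ha
    · rw [(hsub ⟨h, hθ.2.trans_lt hy.2⟩).1]
      exact Finset.mem_singleton_self a
  have hsum : (∑ θ ∈ B, if θ ≤ y then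
      tangentMax Λ hΛ (circleMap 0 1 θ) - tangentMin Λ hΛ (circleMap 0 1 θ) else 0) =
      ∑ θ ∈ B, if θ ≤ x then
      tangentMax Λ hΛ (circleMap 0 1 θ) - tangentMin Λ hΛ (circleMap 0 1 θ) else 0 :=
    Finset.sum_congr rfl fun θ hθ => by simp only [(hsub ⟨hxy, hy.2⟩).2 θ hθ]
  have hadd := intervalIntegral.integral_add_adjacent_intervals
    (intervalIntegrable_supportFun hΛ 0 x) (intervalIntegrable_supportFun hΛ x y)
  rw [supportPotential, supportPotential, hsum, ← hadd, hint, integral_inner_circleMap, hta,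
    tangentMax_eq hΛ (hsub ⟨hxy, hy.2⟩).1]
  ring

/-- As y increases to x, `tangentMax` tends to `tangentMin` at x. The missing jump at x is supplied
by the term θ = x of the sum, or vanishes when x is not in B. -/
theorem supportPotential_left (hΛ : Λ.Nonempty) (B : Finset ℝ) {x : ℝ}
    (hx : x ∉ B → tangentMax Λ hΛ (circleMap 0 1 x) - tangentMin Λ hΛ (circleMap 0 1 x) = 0) :
    ∃ z, z < x ∧ ∀ y ∈ Ioc z x, supportPotential Λ hΛ B y = supportPotential Λ hΛ B x := by
  obtain ⟨a, ha, hta, hev⟩ := exists_dominant_left hΛ x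
  have hB : ∀ᶠ y in 𝓝[<] x, ∀ θ ∈ B, (θ ≤ y ↔ θ < x) := by
    refine (eventually_all_finset B).2 fun θ _ => ?_
    rcases lt_or_ge θ x with h | h
    · filter_upwards [nhdsWithin_le_nhds (Ioi_mem_nhds h)] with y hy
      exact ⟨fun _ => h, fun _ => le_of_lt hy⟩
    · filter_upwards [self_mem_nhdsWithin] with y hy
      exact ⟨fun h' => absurd (h'.trans_lt hy) (not_lt.2 h), fun h' => absurd h' (not_lt.2 h)⟩
  obtain ⟨z, hz, hsub⟩ := mem_nhdsLT_iff_exists_Ioo_subset.1 (hev.and hB)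
  refine ⟨z, hz, fun y hy => ?_⟩
  rcases hy.2.eq_or_lt with rfl | hxy
  · rfl
  have hint : ∫ θ in y..x, supportFun Λ hΛ (circleMap 0 1 θ) =
      ∫ θ in y..x, (inner ℝ (circleMap 0 1 θ) a : ℝ) := by
    refine intervalIntegral.integral_congr fun θ hθ => ?_
    rw [uIcc_of_le hxy.le] at hθ
    refine supportFun_eq hΛ ?_
    rcases hθ.2.eq_or_lt with rfl | h
    · exact ha
    · rw [(hsub ⟨hy.1.trans_le hθ.1, h⟩).1]
      exact Finset.mem_singleton_self a
  have hsum : (∑ θ ∈ B, if θ ≤ x then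
      tangentMax Λ hΛ (circleMap 0 1 θ) - tangentMin Λ hΛ (circleMap 0 1 θ) else 0) =
      (∑ θ ∈ B, if θ ≤ y then
        tangentMax Λ hΛ (circleMap 0 1 θ) - tangentMin Λ hΛ (circleMap 0 1 θ) else 0) +
      (tangentMax Λ hΛ (circleMap 0 1 x) - tangentMin Λ hΛ (circleMap 0 1 x)) := by
    have h1 : (∑ θ ∈ B, if θ = x then
        tangentMax Λ hΛ (circleMap 0 1 θ) - tangentMin Λ hΛ (circleMap 0 1 θ) else 0) =
        tangentMax Λ hΛ (circleMap 0 1 x) - tangentMin Λ hΛ (circleMap 0 1 x) := by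
      rw [Finset.sum_ite_eq']
      split_ifs with h
      · rfl
      · exact (hx h).symm
    rw [← h1, ← Finset.sum_add_distrib]
    refine Finset.sum_congr rfl fun θ hθ => ?_
    have hiff := (hsub ⟨hy.1, hxy⟩).2 θ hθ
    rcases lt_trichotomy θ x with h | h | h
    · rw [if_pos h.le, if_pos (hiff.2 h), if_neg h.ne, add_zero]
    · rw [if_pos h.le, if_neg (fun h' => h.not_lt (hiff.1 h')), if_pos h, zero_add]
    · rw [if_neg h.not_ge, if_neg (fun h' => h.not_gt (hiff.1 h')), if_neg h.ne', add_zero]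
  have hadd := intervalIntegral.integral_add_adjacent_intervals
    (intervalIntegrable_supportFun hΛ 0 y) (intervalIntegrable_supportFun hΛ y x)
  rw [supportPotential, supportPotential, hsum, ← hadd, hint, integral_inner_circleMap, hta,
    tangentMax_eq hΛ (hsub ⟨hy.1, hxy⟩).1]
  ring

/-- This is ∫ (h + h'') over a period, with h'' consisting of the jumps of h'. The potential is
continuous with zero right derivative, hence constant; comparing its values at 0 and 2π, the
tangential terms cancel by periodicity. The half-open interval counts the direction 0 = 2π once. -/
theorem integral_supportFun_eq_sum (hΛ : Λ.Nonempty) (B : Finset ℝ)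
    (hB0 : ∀ θ ∈ B, θ ∈ Ioc 0 (2 * Real.pi))
    (hB : ∀ x ∈ Ioc 0 (2 * Real.pi), x ∉ B →
      tangentMax Λ hΛ (circleMap 0 1 x) - tangentMin Λ hΛ (circleMap 0 1 x) = 0) :
    ∫ θ in (0 : ℝ)..(2 * Real.pi), supportFun Λ hΛ (circleMap 0 1 θ) =
      ∑ θ ∈ B, (tangentMax Λ hΛ (circleMap 0 1 θ) - tangentMin Λ hΛ (circleMap 0 1 θ)) := by
  have hright : ∀ x, supportPotential Λ hΛ B =ᶠ[𝓝[≥] x] fun _ => supportPotential Λ hΛ B x := by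
    intro x
    obtain ⟨z, hz, h⟩ := supportPotential_right hΛ B x
    filter_upwards [Ico_mem_nhdsGE hz] with y hy using h y hy
  have hcont : ContinuousOn (supportPotential Λ hΛ B) (Icc 0 (2 * Real.pi)) := by
    intro x hx
    have hr : ContinuousWithinAt (supportPotential Λ hΛ B) (Ici x) x :=
      continuousWithinAt_const.congr_of_eventuallyEq (hright x) rfl
    rcases hx.1.eq_or_lt with rfl | h0
    · exact hr.mono Icc_subset_Ici_self
    · obtain ⟨z, hz, h⟩ := supportPotential_left hΛ B (hB x ⟨h0, hx.2⟩)
      have hl : ContinuousWithinAt (supportPotential Λ hΛ B) (Iic x) x := by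
        refine (continuousWithinAt_const (b := supportPotential Λ hΛ B x)).congr_of_eventuallyEq
          ?_ rfl
        filter_upwards [Ioc_mem_nhdsLE hz] with y hy using h y hy
      exact (hl.union hr).mono fun y _ => le_total y x
  have hconst := constant_of_has_deriv_right_zero hcont
    (fun x _ => (hasDerivWithinAt_const x (Ici x)
      (supportPotential Λ hΛ B x)).congr_of_eventuallyEq (hright x) rfl)
    (2 * Real.pi) ⟨Real.two_pi_pos.le, le_rfl⟩
  have hper : circleMap 0 1 (2 * Real.pi) = circleMap 0 1 0 := by simp [circleMap]
  have h1 : (∑ θ ∈ B, if θ ≤ 2 * Real.pi then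
      tangentMax Λ hΛ (circleMap 0 1 θ) - tangentMin Λ hΛ (circleMap 0 1 θ) else 0) =
      ∑ θ ∈ B, (tangentMax Λ hΛ (circleMap 0 1 θ) - tangentMin Λ hΛ (circleMap 0 1 θ)) :=
    Finset.sum_congr rfl fun θ hθ => if_pos (hB0 θ hθ).2
  have h2 : (∑ θ ∈ B, if θ ≤ 0 then
      tangentMax Λ hΛ (circleMap 0 1 θ) - tangentMin Λ hΛ (circleMap 0 1 θ) else 0) = 0 :=
    Finset.sum_eq_zero fun θ hθ => if_neg (not_le.2 (hB0 θ hθ).1)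
  rw [supportPotential, supportPotential, hper, h1, h2, intervalIntegral.integral_same] at hconst
  linarith

/-- **Cauchy's formula** for the perimeter of a convex polygon. -/
theorem circleAverage_supportFun (hΛ : Λ.Nonempty) :
    Real.circleAverage (supportFun Λ hΛ) 0 1 = semiperimeter (newtonPolygon Λ) / Real.pi := by
  set G : ℂ → ℝ := fun u => Metric.diam (face (newtonPolygon Λ) u) with hG
  have hbij : BijOn (circleMap 0 1) (Ioc 0 (2 * Real.pi)) (Metric.sphere 0 1) := by
    have himg := image_circleMap_Ioc 0 1
    rw [abs_one] at himg
    refine himg ▸ InjOn.bijOn_image ?_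
    have := injOn_circleMap_of_abs_sub_le (a := 0) (b := 2 * Real.pi) (R := 1) (c := 0)
      one_ne_zero (by simp [abs_of_pos Real.pi_pos])
    rwa [uIoc_of_le Real.two_pi_pos.le] at this
  have hfin : {θ | θ ∈ Ioc 0 (2 * Real.pi) ∧ G (circleMap 0 1 θ) ≠ 0}.Finite := by
    refine Set.Finite.of_finite_image ((finite_sides Λ).subset ?_)
      (hbij.injOn.mono fun θ hθ => hθ.1)
    rintro _ ⟨θ, hθ, rfl⟩
    exact ⟨hbij.mapsTo hθ.1, hθ.2⟩
  have hGd : ∀ θ, G (circleMap 0 1 θ) =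
      tangentMax Λ hΛ (circleMap 0 1 θ) - tangentMin Λ hΛ (circleMap 0 1 θ) := fun θ =>
    diam_face hΛ (norm_circleMap_one θ)
  have hsum := integral_supportFun_eq_sum hΛ hfin.toFinset
    (fun θ hθ => ((Set.Finite.mem_toFinset hfin).1 hθ).1) (fun x hx hxB => by
      by_contra h
      exact hxB ((Set.Finite.mem_toFinset hfin).2 ⟨hx, by rwa [hGd]⟩))
  have hsemi : ∑ᶠ u ∈ Metric.sphere (0 : ℂ) 1, G u =
      ∑ θ ∈ hfin.toFinset, G (circleMap 0 1 θ) := by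
    rw [← finsum_mem_eq_of_bijOn (f := fun θ => G (circleMap 0 1 θ)) _ hbij fun _ _ => rfl]
    refine finsum_mem_eq_sum_of_inter_support_eq _ ?_
    ext θ
    simp only [mem_inter_iff, Function.mem_support, Set.Finite.coe_toFinset, mem_ofPred_eq]
    tauto
  rw [semiperimeter, hsemi, Real.circleAverage_def, hsum, smul_eq_mul]
  simp only [hGd]
  have := Real.pi_pos
  field_simp

end ExponentialSum

/-! ### Asymptotics of the zero count -/

namespace ExponentialSum

variable {Λ : Finset ℂ} {c : ℂ → ℂ}

/-- Circle averages of the logarithm of the sum of absolute values grow linearly. -/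
theorem exists_circleAverage_log_absSum_sub (hΛ : Λ.Nonempty) (hc : ∀ a ∈ Λ, c a ≠ 0) :
    ∃ C : ℝ, 0 ≤ C ∧ ∀ s t : ℝ, 0 < s → s ≤ t →
      |Real.circleAverage (fun z => Real.log (absSum Λ c z)) 0 t -
        Real.circleAverage (fun z => Real.log (absSum Λ c z)) 0 s -
          (t - s) * (semiperimeter (newtonPolygon Λ) / Real.pi)| ≤ C / s := by
  obtain ⟨C₁, hC₁, hray⟩ := exists_log_absSum_ray hΛ hc
  obtain ⟨C₂, hC₂, hpair⟩ := exists_circleAverage_pairSum_le Λ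
  refine ⟨C₁ * C₂, by positivity, fun s t hs hst => ?_⟩
  have hmul : ∀ r θ : ℝ, circleMap 0 r θ = (r : ℂ) * circleMap 0 1 θ := fun r θ => by
    simp [circleMap]
  have hS : ∀ r : ℝ, IntervalIntegrable (fun θ => Real.log (absSum Λ c (circleMap 0 r θ)))
      MeasureTheory.volume 0 (2 * Real.pi) := circleIntegrable_log_absSum hΛ hc
  have hh := intervalIntegrable_supportFun hΛ 0 (2 * Real.pi)
  have hW : IntervalIntegrable (fun θ => pairSum Λ (circleMap 0 s θ))
      MeasureTheory.volume 0 (2 * Real.pi) :=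
    ((continuous_pairSum Λ).comp (continuous_circleMap 0 s)).intervalIntegrable _ _
  have h1 : ∫ θ in (0 : ℝ)..(2 * Real.pi), (Real.log (absSum Λ c (circleMap 0 t θ)) -
      Real.log (absSum Λ c (circleMap 0 s θ))) ≤
      ∫ θ in (0 : ℝ)..(2 * Real.pi), (t - s) * supportFun Λ hΛ (circleMap 0 1 θ) := by
    refine intervalIntegral.integral_mono_on Real.two_pi_pos.le ((hS t).sub (hS s))
      (hh.const_mul _) fun θ _ => ?_
    rw [hmul t, hmul s]
    exact (hray _ s t hs.le hst).1
  have h2 : ∫ θ in (0 : ℝ)..(2 * Real.pi), ((t - s) * supportFun Λ hΛ (circleMap 0 1 θ) -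
      C₁ * pairSum Λ (circleMap 0 s θ)) ≤
      ∫ θ in (0 : ℝ)..(2 * Real.pi), (Real.log (absSum Λ c (circleMap 0 t θ)) -
      Real.log (absSum Λ c (circleMap 0 s θ))) := by
    refine intervalIntegral.integral_mono_on Real.two_pi_pos.le
      ((hh.const_mul _).sub (hW.const_mul _)) ((hS t).sub (hS s)) fun θ _ => ?_
    rw [hmul t, hmul s]
    exact (hray _ s t hs.le hst).2
  rw [intervalIntegral.integral_sub (hS t) (hS s), intervalIntegral.integral_const_mul] at h1
  rw [intervalIntegral.integral_sub (hS t) (hS s), intervalIntegral.integral_sub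
    (hh.const_mul _) (hW.const_mul _), intervalIntegral.integral_const_mul,
    intervalIntegral.integral_const_mul] at h2
  have hp : 0 ≤ (2 * Real.pi)⁻¹ := inv_nonneg.2 Real.two_pi_pos.le
  have h3 := mul_le_mul_of_nonneg_left h1 hp
  have h4 := mul_le_mul_of_nonneg_left h2 hp
  have h5 := mul_le_mul_of_nonneg_left (hpair s hs) hC₁
  rw [← circleAverage_supportFun hΛ]
  simp only [Real.circleAverage_def, smul_eq_mul] at h5 ⊢
  rw [mul_div_assoc, abs_le]
  have hpos : 0 ≤ C₁ * (C₂ / s) := by positivity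
  constructor <;> linarith

/-- On suitable circles in every annulus of width one, the number of zeros is known up to a
bounded error. -/
theorem exists_radius_zeroCount (hΛ : Λ.Nonempty) (hc : ∀ a ∈ Λ, c a ≠ 0) :
    ∃ C : ℝ, ∀ r : ℝ, 2 ≤ r → ∃ t ∈ Set.Icc r (r + 1),
      |(zeroCount (expSum Λ c) t : ℝ) - t * (semiperimeter (newtonPolygon Λ) / Real.pi)| ≤ C := by
  obtain ⟨w, hw⟩ := exists_expSum_ne_zero hΛ hc
  have hf := differentiable_expSum Λ c
  obtain ⟨C₁, hC₁, hrad⟩ := exists_radius_circleAverage_ge hΛ hc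
  obtain ⟨C₂, hC₂, hgrow⟩ := exists_circleAverage_log_absSum_sub hΛ hc
  set l := semiperimeter (newtonPolygon Λ) / Real.pi with hl
  -- The upper bound for n is (t + 1)(l + (C₁ + C₂)/t) with (t + 1)/t ≤ 2, the lower one is (t -
  -- 1)(l - C₁/t) - C₂; both differ from t * l by at most this constant.
  refine ⟨|l| + 2 * (C₁ + C₂), fun r hr => ?_⟩
  obtain ⟨t, htr, ht⟩ := hrad r (by linarith)
  refine ⟨t, htr, ?_⟩
  have ht2 : 2 ≤ t := hr.trans htr.1
  have ht0 : 0 < t := by linarith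
  -- The radius t is the inner one in the first inequality and the outer one in the second, so a
  -- lower bound for the average of log|f| is used at t only.
  have hup := zeroCount_mul_log_le hf hw ht0 (show t ≤ t + 1 by linarith)
  have hlow := le_zeroCount_mul_log hf hw (show 0 < t - 1 by linarith) (show t - 1 ≤ t by linarith)
  have hM1 := circleAverage_log_norm_expSum_le hΛ hc (show 0 < t + 1 by linarith)
  have hM2 := circleAverage_log_norm_expSum_le hΛ hc (show 0 < t - 1 by linarith)
  have hg1 := (abs_le.1 (hgrow t (t + 1) ht0 (by linarith))).2
  have hg2 := (abs_le.1 (hgrow (t - 1) t (by linarith) (by linarith))).1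
  have hn0 : (0 : ℝ) ≤ zeroCount (expSum Λ c) t := Nat.cast_nonneg _
  set n : ℝ := (zeroCount (expSum Λ c) t : ℝ) with hn
  have hlog1 : 1 / (t + 1) ≤ Real.log (t + 1) - Real.log t := by
    have := Real.one_sub_inv_le_log_of_pos (x := (t + 1) / t) (by positivity)
    rw [Real.log_div (by positivity) ht0.ne'] at this
    refine le_trans (le_of_eq ?_) this
    field_simp
    ring
  have ht1 : 0 < t - 1 := by linarith
  have hlog2 : Real.log t - Real.log (t - 1) ≤ 1 / (t - 1) := by
    have := Real.log_le_sub_one_of_pos (x := t / (t - 1)) (by positivity)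
    rw [Real.log_div ht0.ne' ht1.ne'] at this
    refine this.trans (le_of_eq ?_)
    field_simp
    ring
  have hA : n * (1 / (t + 1)) ≤ l + C₁ / t + C₂ / t := by
    have := mul_le_mul_of_nonneg_left hlog1 hn0
    linarith
  have hB : l - C₁ / t - C₂ / (t - 1) ≤ n * (1 / (t - 1)) := by
    have := mul_le_mul_of_nonneg_left hlog2 hn0
    linarith
  rw [mul_one_div, div_le_iff₀ (by positivity)] at hA
  rw [mul_one_div, le_div_iff₀ ht1] at hB
  have e1 : (C₁ / t + C₂ / t) * (t + 1) ≤ 2 * (C₁ + C₂) := by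
    rw [← add_div, div_mul_eq_mul_div, div_le_iff₀ ht0]
    nlinarith
  have e2 : C₁ / t * (t - 1) ≤ C₁ := by
    rw [div_mul_eq_mul_div, div_le_iff₀ ht0]
    nlinarith
  have e3 : C₂ / (t - 1) * (t - 1) = C₂ := div_mul_cancel₀ _ ht1.ne'
  have e4 := le_abs_self l
  rw [abs_le]
  constructor
  · nlinarith
  · nlinarith

end ExponentialSum

theorem theorem4 (Λ : Finset ℂ) (c : ℂ → ℂ) (hΛ : Λ.Nonempty) (hc : ∀ a ∈ Λ, c a ≠ 0) :
    (∀ r : ℝ, {z : ℂ | z ∈ Metric.closedBall (0 : ℂ) r ∧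
      ExponentialSum.expSum Λ c z = 0}.Finite) ∧
    ∃ C : ℝ, ∀ r : ℝ, 0 ≤ r →
      |(ExponentialSum.zeroCount (ExponentialSum.expSum Λ c) r : ℝ) -
        r / Real.pi * ExponentialSum.semiperimeter (ExponentialSum.newtonPolygon Λ)| ≤ C := by
  obtain ⟨w, hw⟩ := ExponentialSum.exists_expSum_ne_zero hΛ hc
  have hf := ExponentialSum.differentiable_expSum Λ c
  refine ⟨ExponentialSum.finite_zeros hf hw, ?_⟩
  obtain ⟨C, hC⟩ := ExponentialSum.exists_radius_zeroCount hΛ hc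
  have hmono := ExponentialSum.zeroCount_mono hf hw
  set n := ExponentialSum.zeroCount (ExponentialSum.expSum Λ c) with hn
  set l := ExponentialSum.semiperimeter (ExponentialSum.newtonPolygon Λ) / Real.pi with hl
  refine ⟨C + 3 * |l| + n 3, fun r hr => ?_⟩
  have hrl : r / Real.pi * ExponentialSum.semiperimeter (ExponentialSum.newtonPolygon Λ) =
      r * l := by rw [hl]; ring
  have hC0 : 0 ≤ C := by
    obtain ⟨t, -, ht⟩ := hC 2 le_rfl
    exact (abs_nonneg _).trans ht
  have hn3 : (0 : ℝ) ≤ n 3 := Nat.cast_nonneg _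
  have hnr : (0 : ℝ) ≤ n r := Nat.cast_nonneg _
  have key : ∀ t : ℝ, |t - r| ≤ 1 → |t * l - r * l| ≤ |l| := fun t ht => by
    rw [← sub_mul, abs_mul]
    exact mul_le_of_le_one_left (abs_nonneg l) ht
  rw [hrl]
  -- Small radii are absorbed by `n 3`. For r ≥ 3 good radii exist in [r - 1, r] and in [r, r + 1],
  -- because r - 1 ≥ 2, and their counts enclose `n r`.
  rcases le_total r 3 with h3 | h3
  · have h1 : (n r : ℝ) ≤ n 3 := by exact_mod_cast hmono h3
    have h2 : |r * l| ≤ 3 * |l| := by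
      rw [abs_mul, abs_of_nonneg hr]
      gcongr
    rw [abs_le] at h2 ⊢
    constructor <;> linarith [h2.1, h2.2]
  · obtain ⟨t, htr, ht⟩ := hC r (by linarith)
    obtain ⟨s, hsr, hs⟩ := hC (r - 1) (by linarith)
    have h1 : (n r : ℝ) ≤ n t := by exact_mod_cast hmono htr.1
    have h2 : (n s : ℝ) ≤ n r := by exact_mod_cast hmono (show s ≤ r by linarith [hsr.2])
    have h4 := key t (by rw [abs_le]; constructor <;> linarith [htr.1, htr.2])
    have h5 := key s (by rw [abs_le]; constructor <;> linarith [hsr.1, hsr.2])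
    rw [abs_le] at ht hs h4 h5 ⊢
    have := abs_nonneg l
    constructor <;> linarith [ht.1, ht.2, hs.1, hs.2, h4.1, h4.2, h5.1, h5.2]
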